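/- **Setting.** Consider a flow network with finite node set $\mathcal V$ ($|\mathcal V|=n$) and finite edge set $\mathcal E$ ($|\mathcal E|=m$), in which every edge has two distinct ends, labelled arbitrarily $+$ and $-$. Let $B\in\mathbb R^{n\times m}$ be its incidence matrix ($+1$, $-1$ at the positive and negative end of each edge, $0$ otherwise). Let $\mathcal V_e\subseteq\mathcal V$ be the set of the $p$ nodes with a controllable input, and let $E\in\mathbb R^{n\times p}$ be the corresponding indicator matrix. With constant disturbance $d\in\mathbb R^n$, state $x$, flows $\lambda$, inputs $u$ and output $y$, the network is $$T_x\dot x=-B\lambda+Eu-d,\qquad y=h(x)=(h_i(x_i))_{i\in\mathcal V},$$ where each $h_i:\mathbb R\to\mathbb R$ is continuously differentiable and strictly increasing. Let $\overline y\in\mathbb R^n$ be a setpoint. Input costs are $C(u)=\sum_{i\in\mathcal V_e}(\tfrac12q_iu_i^2+r_iu_i+s_i)$ with $q_i>0$; put $Q=\mathrm{diag}(q_i)$. Let $$\overline u=Q^{-1}(\kappa-r),\qquad \kappa=E^T\frac{\mathbf 1_n\mathbf 1_n^T}{\mathbf 1_p^TQ^{-1}\mathbf 1_p}\,(d+EQ^{-1}r).$$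 The network is closed with the flow controller $$T_\mu\dot\mu=B^T(h(x)-\overline y)-(f(\mu)-\xi),\quad T_\xi\dot\xi=f(\mu)-\xi,\quad \lambda=f(\mu)=(f_k(\mu_k))_{k\in\mathcal E},$$ and the node controller $$T_\theta\dot\theta=-E^T(h(x)-\overline y)-(g(\theta)-\phi),\quad T_\phi\dot\phi=g(\theta)-\phi-QL^{com}(Q\phi+r),\quad u=g(\theta)=(g_i(\theta_i))_{i\in\mathcal V_e}.$$ Here $T_x,T_\mu,T_\xi,T_\theta,T_\phi$ are diagonal with positive entries, and $L^{com}$ is the Laplacian of a directed communication graph on $\mathcal V_e$ with nonnegative weights. **Assumptions.** 1. The graph of the network is connected. 2. $p\ge1$. 3. $\overline y_i$ lies in the range $\mathcal R(h_i)$ for every node $i$. 4. The communication graph is balanced (weighted in-degree equals weighted out-degree at every node) and strongly connected. 5. There is $\omega\in\mathbb R^m$ with $[B^\dagger(E\overline u-d)+(I-B^\dagger B)\omega]_k\in\mathcal R(f_k)$ for all $k\in\mathcal E$, where $B^\dagger$ is the Moore–Penrose pseudoinverse; and $\overline u_i\in\mathcal R(g_i)$ for all $i\in\mathcal V_e$.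 6. All $f_k,g_i:\mathbb R\to\mathbb R$ are continuously differentiable and strictly increasing, with $\mathcal R(f_k)=(\lambda_k^-,\lambda_k^+)$ and $\mathcal R(g_i)=(u_i^-,u_i^+)$, where the given limits may be infinite. **Theorem.** Under these assumptions the following hold. (a) $\overline u$ is the unique optimal input: it is the unique $u$-component of the minimizers of $C(u)$ over all $(u,\lambda)$ with $\mathbf 0=-B\lambda+Eu-d$. (b) The controllers are distributed: the controller of an edge uses only its own state and the outputs at the two ends of the edge; the controller of an actuated node uses only its own state, the output at that node and the values of $\phi$ at its neighbours in the communication graph. (c) The closed loop has an equilibrium, and for every initial state it has a unique solution, defined for all $t\ge0$. (d) Let $(\overline x,\overline\mu,\overline\xi,\overline\theta,\overline\phi)$ be any equilibrium and $$\Upsilon_1=\{(x,\mu,\xi,\theta,\phi): B(f(\mu)-f(\overline\mu))=\mathbf 0,\ B(\xi-\overline\xi)=\mathbf 0,\ x=\overline x,\ \theta=\overline\theta,\ \phi=\overline\phi\}.$$ At every point of $\Upsilon_1$ one has $h(x)=\overline y$ and $g(\theta)=\overline u$. Every solution on $[0,\infty)$, from whatever initial state, converges as $t\to\infty$ to a single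 point of $\Upsilon_1$; this point is an equilibrium, and $\lambda(t)=f(\mu(t))$ converges to its constant flow vector. (e) Along every solution, $h(x(t))\to\overline y$ and $u(t)=g(\theta(t))\to\overline u$ as $t\to\infty$, and for all $t\ge0$, $k\in\mathcal E$, $i\in\mathcal V_e$, $$\lambda_k^-<\lambda_k(t)<\lambda_k^+,\qquad u_i^-<u_i(t)<u_i^+ .$$ -/

import Mathlib

open Matrix Filter Topology

namespace FlowRegulation

/-- `P` is the Moore-Penrose pseudoinverse of the real matrix `A` (the four Penrose equations). -/
structure IsPseudoinverse {m n : Type*} [Fintype m] [Fintype n]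
    (A : Matrix m n ℝ) (P : Matrix n m ℝ) : Prop where
  mul_mul_self : A * P * A = A
  self_mul_mul : P * A * P = P
  symm_left : (A * P)ᵀ = A * P
  symm_right : (P * A)ᵀ = P * A

/-- A flow network with node set `V` and edge set `K`. Every edge `k` has two distinct ends, labelled
(arbitrarily) as the positive end `pos k` and the negative end `neg k`. -/
structure FlowNetwork (V K : Type*) where
  pos : K → V
  neg : K → V
  pos_ne_neg : ∀ k, pos k ≠ neg k
  /-- the nodes with a controllable external input -/
  act : Finset V
  /-- the time constants of the nodes -/
  Tx : V → ℝ
  Tx_pos : ∀ i, 0 < Tx i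
  /-- the output maps of the nodes -/
  h : V → ℝ → ℝ
  h_contDiff : ∀ i, ContDiff ℝ 1 (h i)
  h_strictMono : ∀ i, StrictMono (h i)
  /-- the constant disturbance -/
  d : V → ℝ

/-- The control specification: setpoint, linear-quadratic input costs, and flow and input limits.
Infinite limits mean that there is no constraint. -/
structure Spec {V K : Type*} (N : FlowNetwork V K) where
  ybar : V → ℝ
  q : N.act → ℝ
  q_pos : ∀ i, 0 < q i
  r : N.act → ℝ
  s : N.act → ℝ
  flowLo : K → EReal
  flowHi : K → EReal
  inputLo : N.act → EReal
  inputHi : N.act → EReal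

/-- The data of the flow controller and of the node controller. The number `weight i j ≥ 0` is the
weight of the directed communication link between the actuated nodes `i` and `j`; the link is present
when the weight is nonzero. -/
structure Controller {V K : Type*} (N : FlowNetwork V K) where
  Tmu : K → ℝ
  Txi : K → ℝ
  Ttheta : N.act → ℝ
  Tphi : N.act → ℝ
  Tmu_pos : ∀ k, 0 < Tmu k
  Txi_pos : ∀ k, 0 < Txi k
  Ttheta_pos : ∀ i, 0 < Ttheta i
  Tphi_pos : ∀ i, 0 < Tphi i
  f : K → ℝ → ℝ
  g : N.act → ℝ → ℝ
  weight : N.act → N.act → ℝ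
  weight_nonneg : ∀ i j, 0 ≤ weight i j

variable {V K : Type*} [Fintype V] [DecidableEq V] [Fintype K]

/-! ### The network -/

/-- The underlying undirected graph: two nodes are adjacent if some edge joins them. -/
def FlowNetwork.graph {V K : Type*} (N : FlowNetwork V K) : SimpleGraph V :=
  SimpleGraph.fromRel fun i j => ∃ k, N.pos k = i ∧ N.neg k = j

/-- The incidence matrix. -/
def FlowNetwork.B (N : FlowNetwork V K) : Matrix V K ℝ :=
  Matrix.of fun i k => if i = N.pos k then 1 else if i = N.neg k then -1 else 0

/-- The indicator matrix of the controllable external inputs. -/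
def FlowNetwork.E (N : FlowNetwork V K) : Matrix V N.act ℝ :=
  Matrix.of fun i j => if i = (j : V) then 1 else 0

/-- The output `y = h(x)`. -/
def FlowNetwork.output (N : FlowNetwork V K) (x : V → ℝ) : V → ℝ := fun i => N.h i (x i)

/-- The right-hand side `-Bλ + Eu - d` of the network dynamics `T_x ẋ = -Bλ + Eu - d`. -/
def FlowNetwork.rhs (N : FlowNetwork V K) (lam : K → ℝ) (u : N.act → ℝ) : V → ℝ :=
  -(N.B *ᵥ lam) + N.E *ᵥ u - N.d

/-! ### The optimal input -/

section Optimal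

variable {N : FlowNetwork V K} (S : Spec N)

/-- The cost matrix `Q`. -/
def Spec.Q : Matrix N.act N.act ℝ := Matrix.diagonal S.q

/-- The total cost `C(u)`. -/
noncomputable def Spec.cost (u : N.act → ℝ) : ℝ := ∑ i, (1 / 2 * S.q i * u i ^ 2 + S.r i * u i + S.s i)

/-- `κ = Eᵀ (𝟙ₙ 𝟙ₙᵀ / (𝟙ₚᵀ Q⁻¹ 𝟙ₚ)) (d + E Q⁻¹ r)`. -/
noncomputable def Spec.kappa : N.act → ℝ :=
  (N.E)ᵀ *ᵥ (((1 : N.act → ℝ) ⬝ᵥ ((S.Q)⁻¹ *ᵥ 1))⁻¹ •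
    (Matrix.vecMulVec (1 : V → ℝ) (1 : V → ℝ) *ᵥ (N.d + N.E *ᵥ ((S.Q)⁻¹ *ᵥ S.r))))

/-- The input `ū = Q⁻¹ (κ - r)`. -/
noncomputable def Spec.ubar : N.act → ℝ := (S.Q)⁻¹ *ᵥ (S.kappa - S.r)

/-- `u` is an optimal input: together with some `λ` it solves the problem of minimizing `C(u)`
over all `(u, λ)` with `0 = -Bλ + Eu - d`. -/
def Spec.IsOptimalInput (u : N.act → ℝ) : Prop :=
  (∃ lam : K → ℝ, N.rhs lam u = 0) ∧
    ∀ (lam' : K → ℝ) (u' : N.act → ℝ), N.rhs lam' u' = 0 → S.cost u ≤ S.cost u'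

end Optimal

/-! ### The controllers and the closed loop -/

section ClosedLoop

variable {N : FlowNetwork V K} (S : Spec N) (C : Controller N)

/-- The Laplacian of the weighted directed communication graph. -/
def Controller.Lcom : Matrix N.act N.act ℝ :=
  Matrix.diagonal (fun i => ∑ j, C.weight i j) - Matrix.of C.weight

/-- The flows `λ = f(μ)`. -/
def Controller.flow (mu : K → ℝ) : K → ℝ := fun k => C.f k (mu k)

/-- The inputs `u = g(θ)`. -/
def Controller.input (theta : N.act → ℝ) : N.act → ℝ := fun i => C.g i (theta i)

/-- Right-hand side of `T_μ μ̇ = Bᵀ(y - ȳ) - (f(μ) - ξ)`. -/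
def Controller.muRhs (y : V → ℝ) (mu xi : K → ℝ) : K → ℝ :=
  (N.B)ᵀ *ᵥ (y - S.ybar) - (C.flow mu - xi)

/-- Right-hand side of `T_ξ ξ̇ = f(μ) - ξ`. -/
def Controller.xiRhs (mu xi : K → ℝ) : K → ℝ := C.flow mu - xi

/-- Right-hand side of `T_θ θ̇ = -Eᵀ(y - ȳ) - (g(θ) - φ)`. -/
def Controller.thetaRhs (y : V → ℝ) (theta phi : N.act → ℝ) : N.act → ℝ :=
  -((N.E)ᵀ *ᵥ (y - S.ybar)) - (C.input theta - phi)

/-- Right-hand side of `T_φ φ̇ = g(θ) - φ - Q L (Qφ + r)`. -/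
def Controller.phiRhs (theta phi : N.act → ℝ) : N.act → ℝ :=
  C.input theta - phi - S.Q *ᵥ (C.Lcom *ᵥ (S.Q *ᵥ phi + S.r))

/-- The controllers are distributed. The controller of an edge only uses its own state and the
outputs at the two ends of the edge. The controller of an actuated node only uses its own state, the
output at that node, and the values of `φ` at its neighbours in the communication network. -/
def Controller.IsDistributed : Prop :=
  (∀ (k : K) (y y' : V → ℝ) (mu mu' xi xi' : K → ℝ),
    y (N.pos k) = y' (N.pos k) → y (N.neg k) = y' (N.neg k) → mu k = mu' k → xi k = xi' k →
      C.muRhs S y mu xi k = C.muRhs S y' mu' xi' k ∧ C.xiRhs mu xi k = C.xiRhs mu' xi' k ∧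
        C.flow mu k = C.flow mu' k) ∧
  (∀ (i : N.act) (y y' : V → ℝ) (theta theta' phi phi' : N.act → ℝ),
    y i = y' i → theta i = theta' i → phi i = phi' i →
    (∀ j, C.weight i j ≠ 0 → phi j = phi' j) →
      C.thetaRhs S y theta phi i = C.thetaRhs S y' theta' phi' i ∧
        C.phiRhs S theta phi i = C.phiRhs S theta' phi' i ∧
        C.input theta i = C.input theta' i)

end ClosedLoop

/-- The state `(x, μ, ξ, θ, φ)` of the closed loop. -/
abbrev State {V K : Type*} (N : FlowNetwork V K) : Type _ :=
  (V → ℝ) × (K → ℝ) × (K → ℝ) × (N.act → ℝ) × (N.act → ℝ)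

namespace State

variable {V K : Type*} {N : FlowNetwork V K} (z : State N)

/-- The component `x`. -/
abbrev x : V → ℝ := z.1
/-- The component `μ`. -/
abbrev mu : K → ℝ := z.2.1
/-- The component `ξ`. -/
abbrev xi : K → ℝ := z.2.2.1
/-- The component `θ`. -/
abbrev theta : N.act → ℝ := z.2.2.2.1
/-- The component `φ`. -/
abbrev phi : N.act → ℝ := z.2.2.2.2

end State

section ClosedLoop

variable {N : FlowNetwork V K} (S : Spec N) (C : Controller N)

/-- The closed-loop vector field: `ż = vectorField z`, where each equation `T ẇ = (…)` of the closed
loop is solved for `ẇ`. -/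
noncomputable def vectorField (z : State N) : State N :=
  (fun i => N.rhs (C.flow (State.mu z)) (C.input (State.theta z)) i / N.Tx i,
   fun k => C.muRhs S (N.output (State.x z)) (State.mu z) (State.xi z) k / C.Tmu k,
   fun k => C.xiRhs (State.mu z) (State.xi z) k / C.Txi k,
   fun i => C.thetaRhs S (N.output (State.x z)) (State.theta z) (State.phi z) i / C.Ttheta i,
   fun i => C.phiRhs S (State.theta z) (State.phi z) i / C.Tphi i)

/-- `z` solves the closed-loop system on the time set `s`. -/
def IsSolutionOn (z : ℝ → State N) (s : Set ℝ) : Prop :=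
  IsIntegralCurveOn z (fun _ => vectorField S C) s

/-- Equilibria of the closed-loop system. -/
def IsEquilibrium (e : State N) : Prop := vectorField S C e = 0

/-- The set `Υ₁`, relative to an equilibrium `e`. -/
def Upsilon (e : State N) : Set (State N) :=
  {z | N.B *ᵥ (C.flow (State.mu z) - C.flow (State.mu e)) = 0 ∧
    N.B *ᵥ (State.xi z - State.xi e) = 0 ∧
    State.x z = State.x e ∧ State.theta z = State.theta e ∧ State.phi z = State.phi e}

/-! ### The assumptions -/

/-- The setpoint is feasible. -/
def FeasibleSetpoint {V K : Type*} {N : FlowNetwork V K} (S : Spec N) : Prop :=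
  ∀ i, S.ybar i ∈ Set.range (N.h i)

/-- The communication graph is balanced (the weighted in-degree and out-degree of every node agree)
and strongly connected. -/
structure BalancedStronglyConnected {V K : Type*} {N : FlowNetwork V K} (C : Controller N) :
    Prop where
  balanced : ∀ i, ∑ j, C.weight i j = ∑ j, C.weight j i
  strong : ∀ i j, Relation.ReflTransGen (fun a b => 0 < C.weight a b) i j

/-- Attainability of the steady state: for the pseudoinverse `P` of `B` there is `ω` such that
`P(Eū - d) + (I - PB)ω` lies in the range of `f`, and `ū` lies in the range of `g`. -/
def Attainable [DecidableEq K] : Prop :=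
  (∃ P : Matrix K V ℝ, IsPseudoinverse N.B P ∧ ∃ w : K → ℝ, ∀ k,
    (P *ᵥ (N.E *ᵥ S.ubar - N.d) + (1 - P * N.B : Matrix K K ℝ) *ᵥ w : K → ℝ) k ∈
      Set.range (C.f k)) ∧
  ∀ i, S.ubar i ∈ Set.range (C.g i)

/-- The controller output functions are continuously differentiable and strictly increasing, and
their ranges are the open intervals given by the flow and input limits. -/
structure AdmissibleOutputs {V K : Type*} {N : FlowNetwork V K} (S : Spec N) (C : Controller N) :
    Prop where
  f_contDiff : ∀ k, ContDiff ℝ 1 (C.f k)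
  g_contDiff : ∀ i, ContDiff ℝ 1 (C.g i)
  f_strictMono : ∀ k, StrictMono (C.f k)
  g_strictMono : ∀ i, StrictMono (C.g i)
  range_f : ∀ k, Set.range (C.f k) = {a : ℝ | S.flowLo k < (a : EReal) ∧ (a : EReal) < S.flowHi k}
  range_g : ∀ i, Set.range (C.g i) = {a : ℝ | S.inputLo i < (a : EReal) ∧ (a : EReal) < S.inputHi i}

end ClosedLoop

end FlowRegulation

open FlowRegulation

/-! The proof is a passivity argument followed by LaSalle's principle. To each scalar state with
output map `φ` and reference value `a₀` belongs the potential `∫ (φ s - φ a₀)`, convex because `φ`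
increases. The energy relative to an equilibrium `e` is the sum of these potentials weighted by the
time constants. Along the closed loop the couplings through `B` and `E` enter the network and the
controllers with opposite signs and cancel; what remains is `-|f(μ) - ξ|² - |g(θ) - φ|²` minus the
Laplacian quadratic form of `Q(φ - ū)` (`energyDeriv_vectorField`). Balance of the communication
graph turns that form into half the sum of weighted squared differences, so the energy never
increases.

The maps `f` and `g` may be bounded, so a potential need not grow faster than linearly.
`HasLinearGrowth` is what strict monotonicity still gives: bounded sublevel sets, hence no blow-up,
and convergence to `e` whenever the energy tends to zero.

If the energy is constant along a solution, the dissipation vanishes: `ξ` and `φ` stand still, then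
`μ` and `θ` by injectivity of `f` and `g`. Their equations give `Bᵀ(y - ȳ) = 0` and `Eᵀ(y - ȳ) = 0`;
connectedness and an actuated node force `y = ȳ`, so `x` stands still too. Thus every limit point
`p` of a solution is an equilibrium. The energy relative to `p` is again nonincreasing and tends to
zero along a subsequence, hence tends to zero, so the whole solution converges to `p` although
equilibria need not be isolated.

At an equilibrium `y - ȳ` is a constant vector; summing the `φ`-equations weighted by `1/q` shows
that the constant is zero. Consensus of the marginal costs `Qφ + r` together with the total balance
of inputs and disturbances then identifies `g(θ)` with `ū`. The limits on flows and inputs are built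
into the ranges of `f` and `g`. -/

namespace FlowRegulation

/-! ### Functions that grow at least linearly away from a point. -/

section Growth

variable {X : Type*} [NormedAddCommGroup X]

/-- A quantitative form of: `W` is nonnegative, radially unbounded, and small only near `e`. -/
def HasLinearGrowth (W : X → ℝ) (e : X) : Prop :=
  ∀ ε > 0, ∃ c > 0, ∀ z, c * (‖z - e‖ - ε) ≤ W z

theorem HasLinearGrowth.norm_le {W : X → ℝ} {e : X} (h : HasLinearGrowth W e) (a : ℝ) :
    ∃ R, ∀ z, W z ≤ a → ‖z‖ ≤ R := by
  obtain ⟨c, hc, h⟩ := h 1 one_pos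
  refine ⟨‖e‖ + (1 + a / c), fun z hz => ?_⟩
  have h1 : ‖z - e‖ - 1 ≤ a / c := by
    rw [le_div_iff₀ hc, mul_comm]
    exact (h z).trans hz
  linarith [norm_le_norm_add_norm_sub' z e]

theorem HasLinearGrowth.tendsto {W : X → ℝ} {e : X} (h : HasLinearGrowth W e) {ι : Type*}
    {l : Filter ι} {z : ι → X} (hz : Tendsto (fun i => W (z i)) l (𝓝 0)) : Tendsto z l (𝓝 e) := by
  rw [tendsto_iff_norm_sub_tendsto_zero, Metric.tendsto_nhds]
  intro ε hε
  obtain ⟨c, hc, h⟩ := h (ε / 2) (half_pos hε)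
  filter_upwards [hz.eventually (gt_mem_nhds (show 0 < c * (ε / 2) by positivity))] with i hi
  have h1 : ‖z i - e‖ - ε / 2 < ε / 2 := lt_of_mul_lt_mul_left ((h _).trans_lt hi) hc.le
  simpa using by linarith

end Growth

/-! ### Autonomous equations: global existence, uniqueness, LaSalle, convergence to a point. -/

section Autonomous

variable {X : Type*} [NormedAddCommGroup X] [NormedSpace ℝ X]

/-- On every ball a `C¹` vector field agrees, up to a factor in `[0, 1]` that is `1` on the ball, with
a bounded and globally Lipschitz vector field. -/
theorem exists_cutoff [FiniteDimensional ℝ X] {v : X → X} (hv : ContDiff ℝ 1 v) (R : ℝ) :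
    ∃ χ : X → ℝ, (∀ z, 0 ≤ χ z) ∧ (∀ z ∈ Metric.closedBall (0 : X) R, χ z = 1) ∧
      (∃ K, LipschitzWith K fun z => χ z • v z) ∧ ∃ M : NNReal, ∀ z, ‖χ z • v z‖ ≤ M := by
  have hpos : 0 < max R 1 := lt_max_of_lt_right one_pos
  let b : ContDiffBump (0 : X) := ⟨max R 1, max R 1 + 1, hpos, lt_add_one _⟩
  have hb : ContDiff ℝ 1 fun z => b z • v z := b.contDiff.smul hv
  have hc : HasCompactSupport fun z => b z • v z := b.hasCompactSupport.smul_right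
  refine ⟨b, fun z => b.nonneg, fun z hz => b.one_of_mem_closedBall ?_,
    hb.lipschitzWith_of_hasCompactSupport hc one_ne_zero, ?_⟩
  · exact Metric.closedBall_subset_closedBall (le_max_left _ _) hz
  · obtain ⟨M, hM⟩ := hc.exists_bound_of_continuous hb.continuous
    exact ⟨M.toNNReal, fun z => (hM z).trans (Real.le_coe_toNNReal M)⟩

/-- The field agrees on the ball with its cutoff, which is `C¹` with compact support and so globally
Lipschitz. -/
theorem exists_lipschitzOnWith_closedBall [FiniteDimensional ℝ X] {v : X → X}
    (hv : ContDiff ℝ 1 v) (R : ℝ) : ∃ K, LipschitzOnWith K v (Metric.closedBall 0 R) := by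
  obtain ⟨χ, -, h1, ⟨K, hK⟩, -⟩ := exists_cutoff hv R
  refine ⟨K, fun x hx y hy => ?_⟩
  simpa [h1 x hx, h1 y hy] using hK x y

theorem IsIntegralCurveOn.hasDerivWithinAt_Ici_of_Ico {v : X → X} {z : ℝ → X} {T t : ℝ}
    (hz : IsIntegralCurveOn z (fun _ => v) (Set.Ico 0 T)) (ht : t ∈ Set.Ico 0 T) :
    HasDerivWithinAt z (v (z t)) (Set.Ici t) t := by
  refine (hz t ht).mono_of_mem_nhdsWithin ?_
  filter_upwards [self_mem_nhdsWithin, mem_nhdsWithin_of_mem_nhds (Iio_mem_nhds ht.2)] with s h1 h2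
  exact ⟨ht.1.trans h1, h2⟩

/-- Two solutions of an autonomous `C¹` equation with the same initial state agree. -/
theorem eqOn_Ico_of_isIntegralCurveOn [FiniteDimensional ℝ X] {v : X → X} (hv : ContDiff ℝ 1 v)
    {T : ℝ} {z w : ℝ → X} (hz : IsIntegralCurveOn z (fun _ => v) (Set.Ico 0 T))
    (hw : IsIntegralCurveOn w (fun _ => v) (Set.Ico 0 T)) (h0 : z 0 = w 0) :
    Set.EqOn z w (Set.Ico 0 T) := by
  intro t ht
  have hsub : Set.Icc 0 t ⊆ Set.Ico 0 T := fun s hs => ⟨hs.1, hs.2.trans_lt ht.2⟩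
  have hzc := hz.continuousOn.mono hsub
  have hwc := hw.continuousOn.mono hsub
  -- Both trajectories over `[0, t]` are compact, so one ball contains them; a Lipschitz constant
  -- there is all that Grönwall needs.
  obtain ⟨R, hR⟩ := ((isCompact_Icc.image_of_continuousOn hzc).union
    (isCompact_Icc.image_of_continuousOn hwc)).isBounded.subset_closedBall 0
  obtain ⟨K, hK⟩ := exists_lipschitzOnWith_closedBall hv R
  have hIco : Set.Ico 0 t ⊆ Set.Icc 0 t := Set.Ico_subset_Icc_self
  exact ODE_solution_unique_of_mem_Icc_right (v := fun _ => v)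
    (s := fun _ => Metric.closedBall 0 R) (fun _ _ => hK) hzc
    (fun s hs => hz.hasDerivWithinAt_Ici_of_Ico (hsub (hIco hs)))
    (fun s hs => hR (Or.inl ⟨s, hIco hs, rfl⟩)) hwc
    (fun s hs => hw.hasDerivWithinAt_Ici_of_Ico (hsub (hIco hs)))
    (fun s hs => hR (Or.inr ⟨s, hIco hs, rfl⟩)) h0 ⟨ht.1, le_rfl⟩

/-- A bounded and globally Lipschitz vector field has solutions on `[0, ∞)`. -/
theorem exists_isIntegralCurveOn_Ici_of_bounded [CompleteSpace X] {v : X → X} {K M : NNReal}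
    (hK : LipschitzWith K v) (hM : ∀ z, ‖v z‖ ≤ M) (x₀ : X) :
    ∃ z : ℝ → X, IsIntegralCurveOn z (fun _ => v) (Set.Ici 0) ∧ z 0 = x₀ := by
  have hloc : ∀ T : NNReal, ∃ z : ℝ → X, z 0 = x₀ ∧
      ∀ t ∈ Set.Icc (0 : ℝ) T, HasDerivWithinAt z (v (z t)) (Set.Icc 0 (T : ℝ)) t := by
    intro T
    -- With speed at most `M` a solution moves by at most `M * T` in time `T`. Taking that as the
    -- radius puts no smallness condition on `T`.
    have h : IsPicardLindelof (fun _ => v) (tmin := 0) (tmax := T) ⟨0, le_rfl, T.2⟩ x₀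
        (M * T) 0 M K :=
      .of_time_independent (fun z _ => hM z) hK.lipschitzOnWith (by simp)
    exact h.exists_eq_forall_mem_Icc_hasDerivWithinAt₀
  choose α h0 hα using hloc
  have hder : ∀ T : NNReal, ∀ t ∈ Set.Ico (0 : ℝ) T,
      HasDerivWithinAt (α T) (v (α T t)) (Set.Ici t) t := by
    intro T t ht
    refine (hα T t ⟨ht.1, ht.2.le⟩).mono_of_mem_nhdsWithin ?_
    filter_upwards [self_mem_nhdsWithin, mem_nhdsWithin_of_mem_nhds (Iio_mem_nhds ht.2)]
      with s h1 h2
    exact ⟨ht.1.trans h1, h2.le⟩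
  have hagree : ∀ S T : NNReal, S ≤ T → Set.EqOn (α S) (α T) (Set.Icc 0 S) := by
    intro S T hST
    have hST' : (S : ℝ) ≤ T := hST
    refine ODE_solution_unique (v := fun _ => v) (fun _ => hK)
      (fun t ht => (hα S t ht).continuousWithinAt) (hder S) (fun t ht => ?_) (fun t ht => ?_)
      ((h0 S).trans (h0 T).symm)
    · exact ((hα T t ⟨ht.1, ht.2.trans hST'⟩).continuousWithinAt).mono
        (Set.Icc_subset_Icc_right hST')
    · exact hder T t ⟨ht.1, ht.2.trans_le hST'⟩
  -- Diagonal gluing: the value at time `t` is that of the solution constructed on `[0, t]`.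
  refine ⟨fun t => α t.toNNReal t, fun t ht => ?_, by simpa using h0 0⟩
  have ht' : 0 ≤ t := ht
  -- The extra unit makes `[0, T]` a neighbourhood of `t` within `[0, ∞)`, so the derivative carries
  -- over to the glued curve.
  let T : NNReal := t.toNNReal + 1
  have hT : (T : ℝ) = t + 1 := by simp [T, ht']
  have key : ∀ s ∈ Set.Icc 0 (T : ℝ), α s.toNNReal s = α T s := fun s hs =>
    hagree _ _ (Real.toNNReal_le_iff_le_coe.2 hs.2) ⟨hs.1, Real.le_coe_toNNReal s⟩
  have htT : t ∈ Set.Icc 0 (T : ℝ) := ⟨ht', by linarith⟩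
  have hnhds : Set.Icc 0 (T : ℝ) ∈ 𝓝[Set.Ici 0] t := by
    filter_upwards [self_mem_nhdsWithin, mem_nhdsWithin_of_mem_nhds
      (Iio_mem_nhds (show t < T by linarith))] with s h1 h2
    exact ⟨h1, h2.le⟩
  have h1 := ((hα T t htT).mono_of_mem_nhdsWithin hnhds)
  rw [← key t htT] at h1
  exact h1.congr_of_eventuallyEq (by filter_upwards [hnhds] with s hs using key s hs) (key t htT)

theorem antitoneOn_comp_of_isIntegralCurveOn {v : X → X} {W : X → ℝ} {W' : X → X →L[ℝ] ℝ}
    (hW : ∀ z, HasFDerivAt W (W' z) z) (hdec : ∀ z, W' z (v z) ≤ 0) {z : ℝ → X}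
    (hz : IsIntegralCurveOn z (fun _ => v) (Set.Ici 0)) :
    AntitoneOn (fun t => W (z t)) (Set.Ici 0) := by
  have hd : ∀ t ∈ Set.Ici (0 : ℝ),
      HasDerivWithinAt (fun t => W (z t)) (W' (z t) (v (z t))) (Set.Ici 0) t :=
    fun t ht => (hW (z t)).comp_hasDerivWithinAt t (hz t ht)
  exact antitoneOn_of_hasDerivWithinAt_nonpos (convex_Ici 0)
    (fun t ht => (hd t ht).continuousWithinAt)
    (fun t ht => (hd t (interior_subset ht)).mono interior_subset) fun t _ => hdec _

theorem exists_norm_le_of_isIntegralCurveOn {v : X → X} {W : X → ℝ} {W' : X → X →L[ℝ] ℝ} {e : X}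
    (hW : ∀ z, HasFDerivAt W (W' z) z) (hdec : ∀ z, W' z (v z) ≤ 0) (hgrow : HasLinearGrowth W e)
    {z : ℝ → X} (hz : IsIntegralCurveOn z (fun _ => v) (Set.Ici 0)) :
    ∃ R, ∀ t, 0 ≤ t → ‖z t‖ ≤ R := by
  obtain ⟨R, hR⟩ := hgrow.norm_le (W (z 0))
  exact ⟨R, fun t ht => hR _ (antitoneOn_comp_of_isIntegralCurveOn hW hdec hz
    (Set.mem_Ici.2 le_rfl) ht ht)⟩

/-- Replace the field by its cutoff on a ball containing the sublevel set of the initial state. The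
cutoff factor is nonnegative, so `W` still decreases along the truncated field; its solution never
leaves the ball, where the two fields agree. -/
theorem exists_isIntegralCurveOn_Ici [FiniteDimensional ℝ X] {v : X → X} (hv : ContDiff ℝ 1 v)
    {W : X → ℝ} {W' : X → X →L[ℝ] ℝ} {e : X} (hW : ∀ z, HasFDerivAt W (W' z) z)
    (hdec : ∀ z, W' z (v z) ≤ 0) (hgrow : HasLinearGrowth W e) (x₀ : X) :
    ∃ z : ℝ → X, IsIntegralCurveOn z (fun _ => v) (Set.Ici 0) ∧ z 0 = x₀ := by
  obtain ⟨R, hR⟩ := hgrow.norm_le (W x₀)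
  obtain ⟨χ, h0, h1, ⟨K, hK⟩, M, hM⟩ := exists_cutoff hv R
  have : CompleteSpace X := FiniteDimensional.complete ℝ X
  obtain ⟨z, hz, hz0⟩ := exists_isIntegralCurveOn_Ici_of_bounded hK hM x₀
  have hanti := antitoneOn_comp_of_isIntegralCurveOn (v := fun z => χ z • v z) hW (fun z => by
    rw [map_smul]; exact mul_nonpos_of_nonneg_of_nonpos (h0 z) (hdec z)) hz
  refine ⟨z, fun t ht => ?_, hz0⟩
  have hb : ‖z t‖ ≤ R := hR _ (by simpa [hz0] using hanti (Set.mem_Ici.2 le_rfl) ht ht)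
  simpa [h1 (z t) (by simpa using hb)] using hz t ht

theorem IsIntegralCurveOn.comp_add_Ici {v : X → X} {z : ℝ → X}
    (hz : IsIntegralCurveOn z (fun _ => v) (Set.Ici 0)) {a : ℝ} (ha : 0 ≤ a) :
    IsIntegralCurveOn (fun t => z (t + a)) (fun _ => v) (Set.Ici 0) := by
  intro t ht
  have ht' : 0 ≤ t := ht
  have hmaps : Set.MapsTo (fun s => s + a) (Set.Ici 0) (Set.Ici 0) :=
    fun s (hs : 0 ≤ s) => add_nonneg hs ha
  have h := (hz (t + a) (add_nonneg ht' ha)).scomp t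
    ((hasDerivAt_id t).add_const a).hasDerivWithinAt hmaps
  rwa [one_smul] at h

/-- **LaSalle's invariance principle**, for an `ω`-limit point `p` of a bounded solution: a Lyapunov
function has zero derivative along the solution that starts at `p`. -/
theorem derivative_eq_zero_of_tendsto [FiniteDimensional ℝ X] {v : X → X} (hv : ContDiff ℝ 1 v)
    {W : X → ℝ} {W' : X → X →L[ℝ] ℝ} (hW : ∀ z, HasFDerivAt W (W' z) z)
    (hdec : ∀ z, W' z (v z) ≤ 0) {z y : ℝ → X}
    (hz : IsIntegralCurveOn z (fun _ => v) (Set.Ici 0))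
    (hy : IsIntegralCurveOn y (fun _ => v) (Set.Ici 0)) {R : ℝ} (hzR : ∀ t, 0 ≤ t → ‖z t‖ ≤ R)
    (hyR : ∀ t, 0 ≤ t → ‖y t‖ ≤ R) {τ : ℕ → ℝ} (hτ : Tendsto τ atTop atTop)
    (hlim : Tendsto (fun n => z (τ n)) atTop (𝓝 (y 0))) {s : ℝ} (hs : 0 ≤ s) :
    W' (y s) (v (y s)) = 0 := by
  have hWc : Continuous W := continuous_iff_continuousAt.2 fun z => (hW z).continuousAt
  have hIci : ∀ {w : ℝ → X}, IsIntegralCurveOn w (fun _ => v) (Set.Ici 0) → ∀ t, 0 ≤ t →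
      HasDerivWithinAt w (v (w t)) (Set.Ici t) t := fun hw t ht =>
    (hw t ht).mono (Set.Ici_subset_Ici.2 ht)
  obtain ⟨K, hK⟩ := exists_lipschitzOnWith_closedBall hv R
  -- Continuous dependence on the initial state (Grönwall on the ball of radius `R`): the time
  -- translates of `z` by `τ n` converge to `y`.
  have hflow : ∀ s, 0 ≤ s → Tendsto (fun n => z (s + τ n)) atTop (𝓝 (y s)) := by
    intro s hs
    rw [tendsto_iff_dist_tendsto_zero]
    have h0 : Tendsto (fun n => dist (z (τ n)) (y 0) * Real.exp (K * (s - 0))) atTop (𝓝 0) := by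
      simpa using (tendsto_iff_dist_tendsto_zero.1 hlim).mul_const (Real.exp (K * (s - 0)))
    refine squeeze_zero' (.of_forall fun n => dist_nonneg) ?_ h0
    filter_upwards [hτ.eventually_ge_atTop 0] with n hn
    have hzn := hz.comp_add_Ici hn
    exact dist_le_of_trajectories_ODE_of_mem (v := fun _ => v)
      (s := fun _ => Metric.closedBall 0 R) (f := fun t => z (t + τ n)) (a := 0) (b := s)
      (fun _ _ => hK) (hzn.continuousOn.mono Set.Icc_subset_Ici_self)
      (fun t ht => hIci hzn t ht.1)
      (fun t ht => by simpa using hzR _ (add_nonneg ht.1 hn))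
      (hy.continuousOn.mono Set.Icc_subset_Ici_self) (fun t ht => hIci hy t ht.1)
      (fun t ht => by simpa using hyR _ ht.1) (by simp) s ⟨hs, le_rfl⟩
  have hanti := antitoneOn_comp_of_isIntegralCurveOn hW hdec hz
  -- `W` decreases along `z`, and `W (y 0)` is a limit of its values at arbitrarily late times,
  -- hence a lower bound. The values at the shifted times `s + τ n` converge to `W (y s)`, so that
  -- obeys the same bound.
  have hconst : ∀ s, 0 ≤ s → W (y s) = W (y 0) := by
    intro s hs
    have hle : ∀ t, 0 ≤ t → W (y 0) ≤ W (z t) := by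
      intro t ht
      refine le_of_tendsto ((hWc.tendsto _).comp hlim) ?_
      filter_upwards [hτ.eventually_ge_atTop t] with n hn
      exact hanti ht (ht.trans hn) hn
    refine le_antisymm (antitoneOn_comp_of_isIntegralCurveOn hW hdec hy (Set.mem_Ici.2 le_rfl)
      hs hs) (ge_of_tendsto ((hWc.tendsto _).comp (hflow s hs)) ?_)
    filter_upwards [hτ.eventually_ge_atTop 0] with n hn
    exact hle _ (add_nonneg hs hn)
  have h1 := (hW (y s)).comp_hasDerivWithinAt s (hy s hs)
  have h2 : HasDerivWithinAt (W ∘ y) 0 (Set.Ici 0) s :=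
    (hasDerivWithinAt_const s _ (W (y 0))).congr (fun t ht => hconst t ht) (hconst s hs)
  exact (uniqueDiffOn_Ici 0 s hs).eq_deriv _ h1 h2

/-- If every equilibrium has a Lyapunov function, and solutions along which one of them is constant
start at an equilibrium, then every solution converges to an equilibrium. -/
theorem exists_tendsto_equilibrium [FiniteDimensional ℝ X] {v : X → X} (hv : ContDiff ℝ 1 v)
    {W : X → X → ℝ} {W' : X → X → X →L[ℝ] ℝ} (hW : ∀ e z, HasFDerivAt (W e) (W' e z) z)
    (hself : ∀ e, W e e = 0) (hdec : ∀ e, v e = 0 → ∀ z, W' e z (v z) ≤ 0)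
    (hgrow : ∀ e, HasLinearGrowth (W e) e) {e : X} (he : v e = 0)
    (hinv : ∀ y : ℝ → X, IsIntegralCurveOn y (fun _ => v) (Set.Ici 0) →
      (∀ s, 0 ≤ s → W' e (y s) (v (y s)) = 0) → v (y 0) = 0)
    {z : ℝ → X} (hz : IsIntegralCurveOn z (fun _ => v) (Set.Ici 0)) :
    ∃ p, v p = 0 ∧ Tendsto z atTop (𝓝 p) := by
  obtain ⟨R, hR⟩ := exists_norm_le_of_isIntegralCurveOn (hW e) (hdec e he) (hgrow e) hz
  obtain ⟨p, -, φ, hφ, hlim⟩ := (isCompact_closedBall (0 : X) R).tendsto_subseq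
    (x := fun n : ℕ => z n) fun n => by simpa using hR n n.cast_nonneg
  have hτ : Tendsto (fun n => (φ n : ℝ)) atTop atTop :=
    tendsto_natCast_atTop_atTop.comp hφ.tendsto_atTop
  obtain ⟨y, hy, rfl⟩ := exists_isIntegralCurveOn_Ici hv (hW e) (hdec e he) (hgrow e) p
  obtain ⟨R', hR'⟩ := exists_norm_le_of_isIntegralCurveOn (hW e) (hdec e he) (hgrow e) hy
  have hp : v (y 0) = 0 := hinv y hy fun s hs =>
    derivative_eq_zero_of_tendsto hv (hW e) (hdec e he) hz hy
      (fun t ht => (hR t ht).trans (le_max_left R R'))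
      (fun t ht => (hR' t ht).trans (le_max_right R R')) hτ hlim hs
  -- The limit point is now known to be an equilibrium, so its own Lyapunov function replaces that
  -- of `e`. Being nonincreasing and null along the subsequence, it tends to zero.
  refine ⟨y 0, hp, (hgrow (y 0)).tendsto ?_⟩
  have hanti := antitoneOn_comp_of_isIntegralCurveOn (hW (y 0)) (hdec _ hp) hz
  have hWlim : Tendsto (fun n => W (y 0) (z (φ n))) atTop (𝓝 0) := by
    have h := (hW (y 0) (y 0)).continuousAt.tendsto.comp hlim
    rwa [hself] at h
  have hnonneg : ∀ x, 0 ≤ W (y 0) x := by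
    intro x
    by_contra! hx
    rcases eq_or_ne x (y 0) with rfl | hne
    · simp [hself] at hx
    · obtain ⟨c, hc, h⟩ := hgrow (y 0) ‖x - y 0‖ (norm_pos_iff.2 (sub_ne_zero.2 hne))
      exact absurd (h x) (by simpa using hx)
  rw [Metric.tendsto_nhds]
  intro ε hε
  obtain ⟨n, hn⟩ := (hWlim.eventually (gt_mem_nhds hε)).exists
  filter_upwards [eventually_ge_atTop (φ n : ℝ)] with t ht
  have h0 : (0 : ℝ) ≤ φ n := Nat.cast_nonneg _
  simpa [abs_of_nonneg (hnonneg _)] using (hanti h0 (h0.trans ht) ht).trans_lt hn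

end Autonomous

/-! ### Potentials of increasing functions and their weighted sums. -/

section Potential

/-- The potential of the increment of `φ` at `a₀`. -/
noncomputable def potential (φ : ℝ → ℝ) (a₀ a : ℝ) : ℝ := ∫ s in a₀..a, (φ s - φ a₀)

theorem potential_self (φ : ℝ → ℝ) (a₀ : ℝ) : potential φ a₀ a₀ = 0 :=
  intervalIntegral.integral_same

theorem hasDerivAt_potential {φ : ℝ → ℝ} (hφ : Continuous φ) (a₀ a : ℝ) :
    HasDerivAt (potential φ a₀) (φ a - φ a₀) a :=
  have hc : Continuous fun s => φ s - φ a₀ := hφ.sub continuous_const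
  intervalIntegral.integral_hasDerivAt_right (hc.intervalIntegrable _ _)
    hc.aestronglyMeasurable.stronglyMeasurableAtFilter hc.continuousAt

/-- Outside the `ε`-neighbourhood of `a₀` the slope of the potential is at least `c` in absolute
value, directed away from `a₀`. Nothing better than linear can be expected, since `φ` may be
bounded. -/
theorem hasLinearGrowth_potential {φ : ℝ → ℝ} (hφ : Continuous φ) (hmono : StrictMono φ)
    (a₀ : ℝ) : HasLinearGrowth (potential φ a₀) a₀ := by
  intro ε hε
  refine ⟨min (φ (a₀ + ε) - φ a₀) (φ a₀ - φ (a₀ - ε)), lt_min (sub_pos.2 (hmono (by linarith)))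
    (sub_pos.2 (hmono (by linarith))), ?_⟩
  set c := min (φ (a₀ + ε) - φ a₀) (φ a₀ - φ (a₀ - ε))
  have hd := hasDerivAt_potential hφ a₀
  have hc : Continuous (potential φ a₀) := continuous_iff_continuousAt.2 fun a => (hd a).continuousAt
  have hc0 : 0 < c := lt_min (sub_pos.2 (hmono (by linarith))) (sub_pos.2 (hmono (by linarith)))
  have hright : MonotoneOn (potential φ a₀) (Set.Ici a₀) := by
    refine monotoneOn_of_hasDerivWithinAt_nonneg (convex_Ici _) hc.continuousOn
      (fun a _ => (hd a).hasDerivWithinAt) fun a ha => sub_nonneg.2 (hmono.monotone ?_)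
    exact interior_subset ha
  have hleft : AntitoneOn (potential φ a₀) (Set.Iic a₀) := by
    refine antitoneOn_of_hasDerivWithinAt_nonpos (convex_Iic _) hc.continuousOn
      (fun a _ => (hd a).hasDerivWithinAt) fun a ha => sub_nonpos.2 (hmono.monotone ?_)
    exact Set.mem_Iic.1 (interior_subset ha)
  have hnonneg : ∀ a, 0 ≤ potential φ a₀ a := by
    intro a
    rw [← potential_self φ a₀]
    rcases le_total a₀ a with h | h
    · exact hright (Set.mem_Ici.2 le_rfl) h h
    · exact hleft h (Set.mem_Iic.2 le_rfl) h
  intro a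
  rw [Real.norm_eq_abs]
  rcases le_or_gt |a - a₀| ε with h | h
  · exact (mul_nonpos_of_nonneg_of_nonpos hc0.le (by linarith)).trans (hnonneg a)
  rcases lt_abs.1 h with h | h
  -- Comparison with the line of slope `c`, started at `a₀ + ε` where the potential is nonnegative;
  -- the other side is symmetric.
  · have hm : MonotoneOn (fun a => potential φ a₀ a - c * a) (Set.Ici (a₀ + ε)) := by
      refine monotoneOn_of_hasDerivWithinAt_nonneg (convex_Ici _)
        (hc.sub (continuous_const.mul continuous_id)).continuousOn
        (fun a _ => ((hd a).sub ((hasDerivAt_id a).const_mul c)).hasDerivWithinAt) fun a ha => ?_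
      have h1 := hmono.monotone (show a₀ + ε ≤ a from interior_subset ha)
      have h2 : c ≤ φ (a₀ + ε) - φ a₀ := min_le_left _ _
      linarith
    have h1 := hm (Set.mem_Ici.2 le_rfl) (show a₀ + ε ≤ a by linarith) (by linarith)
    have h2 := hnonneg (a₀ + ε)
    simp only at h1
    rw [abs_of_pos (by linarith)]
    nlinarith
  · have hm : AntitoneOn (fun a => potential φ a₀ a + c * a) (Set.Iic (a₀ - ε)) := by
      refine antitoneOn_of_hasDerivWithinAt_nonpos (convex_Iic _)
        (hc.add (continuous_const.mul continuous_id)).continuousOn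
        (fun a _ => ((hd a).add ((hasDerivAt_id a).const_mul c)).hasDerivWithinAt) fun a ha => ?_
      have h1 := hmono.monotone (Set.mem_Iic.1 (interior_subset ha))
      have h2 : c ≤ φ a₀ - φ (a₀ - ε) := min_le_right _ _
      linarith
    have h1 := hm (show a ≤ a₀ - ε by linarith) (Set.mem_Iic.2 le_rfl) (by linarith)
    have h2 := hnonneg (a₀ - ε)
    simp only at h1
    rw [abs_of_neg (by linarith)]
    nlinarith

theorem HasLinearGrowth.const_mul {X : Type*} [NormedAddCommGroup X] {W : X → ℝ} {e : X}
    (h : HasLinearGrowth W e) {T : ℝ} (hT : 0 < T) : HasLinearGrowth (fun z => T * W z) e := by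
  intro ε hε
  obtain ⟨c, hc, h⟩ := h ε hε
  refine ⟨T * c, mul_pos hT hc, fun z => ?_⟩
  rw [mul_assoc]
  exact mul_le_mul_of_nonneg_left (h z) hT.le

theorem HasLinearGrowth.nonneg {X : Type*} [NormedAddCommGroup X] {W : X → ℝ} {e : X}
    (h : HasLinearGrowth W e) (h0 : W e = 0) (z : X) : 0 ≤ W z := by
  rcases eq_or_ne z e with rfl | hne
  · exact h0.ge
  · obtain ⟨c, -, h⟩ := h ‖z - e‖ (norm_pos_iff.2 (sub_ne_zero.2 hne))
    simpa using h z

/-- In the sup norm one of the two components carries the whole norm of `z - e`, so its growth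
suffices; the other summand is nonnegative. -/
theorem HasLinearGrowth.prodMk {X Y : Type*} [NormedAddCommGroup X] [NormedAddCommGroup Y]
    {W : X → ℝ} {U : Y → ℝ} {e : X × Y} (hW : HasLinearGrowth W e.1) (hU : HasLinearGrowth U e.2)
    (hW0 : W e.1 = 0) (hU0 : U e.2 = 0) : HasLinearGrowth (fun z : X × Y => W z.1 + U z.2) e := by
  intro ε hε
  obtain ⟨c, hc, h⟩ := hW ε hε
  obtain ⟨c', hc', h'⟩ := hU ε hε
  refine ⟨min c c', lt_min hc hc', fun z => ?_⟩
  have h1 := hW.nonneg hW0 z.1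
  have h2 := hU.nonneg hU0 z.2
  rcases le_or_gt ‖z - e‖ ε with hz | hz
  · exact (mul_nonpos_of_nonneg_of_nonpos (lt_min hc hc').le (by linarith)).trans (add_nonneg h1 h2)
  have hz' : 0 ≤ ‖z - e‖ - ε := by linarith
  rcases max_choice ‖z.1 - e.1‖ ‖z.2 - e.2‖ with hm | hm
  · have hn : ‖z - e‖ = ‖z.1 - e.1‖ := hm
    have := mul_le_mul_of_nonneg_right (min_le_left c c') hz'
    linarith [h z.1, hn ▸ h z.1]
  · have hn : ‖z - e‖ = ‖z.2 - e.2‖ := hm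
    have := mul_le_mul_of_nonneg_right (min_le_right c c') hz'
    linarith [hn ▸ h' z.2]

theorem hasLinearGrowth_sum {ι : Type*} [Fintype ι] {W : ι → ℝ → ℝ} {e : ι → ℝ}
    (hW : ∀ i, HasLinearGrowth (W i) (e i)) (h0 : ∀ i, W i (e i) = 0) :
    HasLinearGrowth (fun z : ι → ℝ => ∑ i, W i (z i)) e := by
  intro ε hε
  choose c hc h using fun i => hW i ε hε
  have hnn : ∀ (z : ι → ℝ) i, 0 ≤ W i (z i) := fun z i => (hW i).nonneg (h0 i) _
  -- The smallest growth constant works for all components; without components any positive number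
  -- does.
  obtain ⟨m, hm, hmc⟩ : ∃ m > 0, ∀ i, m ≤ c i := by
    rcases isEmpty_or_nonempty ι with hι | hι
    · exact ⟨1, one_pos, fun i => isEmptyElim i⟩
    · obtain ⟨i, hi⟩ := Finite.exists_min c
      exact ⟨c i, hc i, hi⟩
  refine ⟨m, hm, fun z => ?_⟩
  have hsum : 0 ≤ ∑ i, W i (z i) := Finset.sum_nonneg fun i _ => hnn z i
  suffices ‖z - e‖ ≤ ε + (∑ i, W i (z i)) / m by
    rw [mul_comm, ← le_div_iff₀ hm]
    linarith
  refine (pi_norm_le_iff_of_nonneg (by positivity)).2 fun i => ?_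
  rcases le_or_gt ‖z i - e i‖ ε with hz | hz
  · exact hz.trans (le_add_of_nonneg_right (by positivity))
  · have h1 := mul_le_mul_of_nonneg_right (hmc i) (show 0 ≤ ‖z i - e i‖ - ε by linarith)
    have h2 := Finset.single_le_sum (fun i _ => hnn z i) (Finset.mem_univ i)
    have h3 : ‖z i - e i‖ - ε ≤ (∑ i, W i (z i)) / m := by
      rw [le_div_iff₀ hm, mul_comm]
      linarith [h i (z i)]
    simpa only [Pi.sub_apply] using by linarith

/-- The weighted sum of the potentials of the components. -/
noncomputable def sumPotential {ι : Type*} [Fintype ι] (T : ι → ℝ) (φ : ι → ℝ → ℝ)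
    (e z : ι → ℝ) : ℝ := ∑ i, T i * potential (φ i) (e i) (z i)

/-- The derivative of `sumPotential`. -/
noncomputable def sumPotentialDeriv {ι : Type*} [Fintype ι] (T : ι → ℝ) (φ : ι → ℝ → ℝ)
    (e z : ι → ℝ) : (ι → ℝ) →L[ℝ] ℝ :=
  ∑ i, (T i * (φ i (z i) - φ i (e i))) • ContinuousLinearMap.proj (R := ℝ) (φ := fun _ : ι => ℝ) i

section Sum

variable {ι : Type*} [Fintype ι] {T : ι → ℝ} {φ : ι → ℝ → ℝ}

theorem sumPotential_self (T : ι → ℝ) (φ : ι → ℝ → ℝ) (e : ι → ℝ) :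
    sumPotential T φ e e = 0 := by
  simp [sumPotential, potential_self]

/-- The weights `T i` are chosen to cancel the time constants by which the closed-loop vector field
divides. -/
theorem sumPotentialDeriv_div (hT : ∀ i, 0 < T i) (φ : ι → ℝ → ℝ) (e z w : ι → ℝ) :
    sumPotentialDeriv T φ e z (fun i => w i / T i) =
      ∑ i, (φ i (z i) - φ i (e i)) * w i := by
  simp only [sumPotentialDeriv, _root_.sum_apply, _root_.smul_apply,
    ContinuousLinearMap.proj_apply, smul_eq_mul]
  refine Finset.sum_congr rfl fun i _ => ?_
  have := (hT i).ne'
  field_simp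

theorem hasFDerivAt_sumPotential (hφ : ∀ i, Continuous (φ i)) (T e z : ι → ℝ) :
    HasFDerivAt (sumPotential T φ e) (sumPotentialDeriv T φ e z) z := by
  unfold sumPotential sumPotentialDeriv
  refine HasFDerivAt.fun_sum fun i _ => ?_
  exact HasDerivAt.comp_hasFDerivAt (h₂ := fun a => T i * potential (φ i) (e i) a) z
    ((hasDerivAt_potential (hφ i) (e i) (z i)).const_mul (T i)) (hasFDerivAt_apply i z)

theorem hasLinearGrowth_sumPotential (hT : ∀ i, 0 < T i) (hφ : ∀ i, Continuous (φ i))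
    (hmono : ∀ i, StrictMono (φ i)) (e : ι → ℝ) : HasLinearGrowth (sumPotential T φ e) e :=
  hasLinearGrowth_sum
    (fun i => (hasLinearGrowth_potential (hφ i) (hmono i) (e i)).const_mul (hT i))
    fun i => by simp [potential_self]

end Sum

theorem hasFDerivAt_add_prod {X Y : Type*} [NormedAddCommGroup X] [NormedSpace ℝ X]
    [NormedAddCommGroup Y] [NormedSpace ℝ Y] {W : X → ℝ} {U : Y → ℝ} {z : X × Y}
    {W' : X →L[ℝ] ℝ} {U' : Y →L[ℝ] ℝ} (hW : HasFDerivAt W W' z.1) (hU : HasFDerivAt U U' z.2) :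
    HasFDerivAt (fun z : X × Y => W z.1 + U z.2)
      (W'.comp (.fst ℝ X Y) + U'.comp (.snd ℝ X Y)) z :=
  (hW.comp z hasFDerivAt_fst).add (hU.comp z hasFDerivAt_snd)

end Potential

/-! ### Incidence and indicator matrices of a connected network. -/

section Network

theorem FlowNetwork.output_injective {V K : Type*} (N : FlowNetwork V K) : Function.Injective N.output := fun _ _ hxy =>
  funext fun i => (N.h_strictMono i).injective (congrFun hxy i)

theorem FlowNetwork.rhs_eq_zero_iff {V K : Type*} [DecidableEq V] [Fintype K] {N : FlowNetwork V K}
    {lam : K → ℝ} {u : N.act → ℝ} :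
    N.rhs lam u = 0 ↔ N.B *ᵥ lam = N.E *ᵥ u - N.d := by
  rw [FlowNetwork.rhs, neg_add_eq_sub, sub_sub, sub_eq_zero, eq_sub_iff_add_eq, eq_comm]

section Input

variable {V K : Type*} [Fintype V] [DecidableEq V] (N : FlowNetwork V K)

theorem FlowNetwork.transpose_E_mulVec (y : V → ℝ) (j : N.act) : ((N.E)ᵀ *ᵥ y) j = y j := by
  simp [FlowNetwork.E, mulVec, dotProduct]

theorem FlowNetwork.dotProduct_E_mulVec (y : V → ℝ) (u : N.act → ℝ) :
    y ⬝ᵥ (N.E *ᵥ u) = ((N.E)ᵀ *ᵥ y) ⬝ᵥ u := by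
  rw [dotProduct_mulVec, mulVec_transpose]

theorem FlowNetwork.sum_E_mulVec (u : N.act → ℝ) : ∑ i, (N.E *ᵥ u) i = ∑ j, u j := by
  have h := N.dotProduct_E_mulVec 1 u
  rwa [one_dotProduct, show (N.E)ᵀ *ᵥ (1 : V → ℝ) = 1 from
    funext fun k => by simp [N.transpose_E_mulVec], one_dotProduct] at h

end Input

variable {V K : Type*} [Fintype V] [DecidableEq V] (N : FlowNetwork V K)

theorem FlowNetwork.transpose_B_mulVec (y : V → ℝ) (k : K) :
    ((N.B)ᵀ *ᵥ y) k = y (N.pos k) - y (N.neg k) := by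
  have h : ∀ i, N.B i k * y i =
      (if i = N.pos k then y i else 0) - (if i = N.neg k then y i else 0) := by
    intro i
    have hne := N.pos_ne_neg k
    by_cases h1 : i = N.pos k
    · subst h1
      simp [FlowNetwork.B, hne]
    · by_cases h2 : i = N.neg k <;> simp [FlowNetwork.B, h1, h2, hne.symm]
  simp only [mulVec, dotProduct, transpose_apply, h, Finset.sum_sub_distrib]
  simp

variable {N} in
theorem FlowNetwork.eq_of_transpose_B_mulVec_eq_zero (hconn : N.graph.Connected) {y : V → ℝ}
    (hy : (N.B)ᵀ *ᵥ y = 0) (i j : V) : y i = y j := by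
  obtain ⟨w⟩ := hconn.preconnected i j
  induction w with
  | nil => rfl
  | cons hadj _ ih =>
    refine Eq.trans ?_ ih
    obtain ⟨-, ⟨k, rfl, rfl⟩ | ⟨k, rfl, rfl⟩⟩ := hadj
    · exact sub_eq_zero.1 ((N.transpose_B_mulVec y k).symm.trans (congrFun hy k))
    · exact (sub_eq_zero.1 ((N.transpose_B_mulVec y k).symm.trans (congrFun hy k))).symm

variable {N} in
-- Connectedness makes `y` constant, and an actuated node fixes the constant to zero.
theorem FlowNetwork.eq_zero_of_transpose_mulVec_eq_zero (hconn : N.graph.Connected)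
    (hact : N.act.Nonempty) {y : V → ℝ} (hB : (N.B)ᵀ *ᵥ y = 0) (hE : (N.E)ᵀ *ᵥ y = 0) : y = 0 := by
  obtain ⟨j, hj⟩ := hact
  funext i
  rw [FlowNetwork.eq_of_transpose_B_mulVec_eq_zero hconn hB i j]
  exact (N.transpose_E_mulVec y ⟨j, hj⟩).symm.trans (congrFun hE _)

variable [Fintype K]

theorem FlowNetwork.dotProduct_B_mulVec (y : V → ℝ) (lam : K → ℝ) :
    y ⬝ᵥ (N.B *ᵥ lam) = ((N.B)ᵀ *ᵥ y) ⬝ᵥ lam := by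
  rw [dotProduct_mulVec, mulVec_transpose]

theorem FlowNetwork.sum_B_mulVec (lam : K → ℝ) : ∑ i, (N.B *ᵥ lam) i = 0 := by
  have h := N.dotProduct_B_mulVec 1 lam
  rw [one_dotProduct] at h
  rw [h, show (N.B)ᵀ *ᵥ (1 : V → ℝ) = 0 from funext fun k => by simp [N.transpose_B_mulVec],
    zero_dotProduct]

variable {N} in
-- By duality: otherwise a linear functional vanishes on the range of `B` but not at `b`. Its
-- coefficient vector lies in the kernel of `Bᵀ`, so it is constant by connectedness and annihilates
-- `b`.
theorem FlowNetwork.exists_B_mulVec_eq (hconn : N.graph.Connected) {b : V → ℝ}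
    (hb : ∑ i, b i = 0) : ∃ lam : K → ℝ, N.B *ᵥ lam = b := by
  by_contra hne
  have hmem : b ∉ LinearMap.range (Matrix.mulVecLin N.B) := fun ⟨lam, h⟩ => hne ⟨lam, h⟩
  obtain ⟨f, hfb, hf⟩ := Submodule.exists_le_ker_of_notMem hmem
  let y : V → ℝ := fun i => f (Pi.single i 1)
  have hfy : ∀ x, f x = y ⬝ᵥ x := by
    intro x
    conv_lhs => rw [pi_eq_sum_univ' x]
    simp [y, dotProduct, mul_comm]
  have hy : (N.B)ᵀ *ᵥ y = 0 := by
    refine dotProduct_eq_zero _ fun lam => ?_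
    rw [← N.dotProduct_B_mulVec, ← hfy]
    exact hf ⟨lam, rfl⟩
  obtain ⟨i₀⟩ := hconn.nonempty
  apply hfb
  rw [hfy, dotProduct, Finset.sum_congr rfl fun i _ => by
    rw [FlowNetwork.eq_of_transpose_B_mulVec_eq_zero hconn hy i i₀], ← Finset.mul_sum, hb, mul_zero]

variable {N} in
theorem FlowNetwork.sum_eq_of_rhs_eq_zero {lam : K → ℝ} {u : N.act → ℝ} (h : N.rhs lam u = 0) :
    ∑ j, u j = ∑ i, N.d i := by
  have h1 : ∑ i, N.rhs lam u i = 0 := by simp [h]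
  simp only [FlowNetwork.rhs, Pi.sub_apply, Pi.add_apply, Pi.neg_apply, Finset.sum_sub_distrib,
    Finset.sum_add_distrib, Finset.sum_neg_distrib, N.sum_B_mulVec, N.sum_E_mulVec] at h1
  linarith

variable {N}

theorem FlowNetwork.exists_rhs_eq_zero (hconn : N.graph.Connected) {u : N.act → ℝ}
    (hu : ∑ j, u j = ∑ i, N.d i) : ∃ lam : K → ℝ, N.rhs lam u = 0 := by
  obtain ⟨lam, h⟩ := FlowNetwork.exists_B_mulVec_eq hconn (b := N.E *ᵥ u - N.d)
    (by simp only [Pi.sub_apply, Finset.sum_sub_distrib, N.sum_E_mulVec, hu, sub_self])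
  exact ⟨lam, FlowNetwork.rhs_eq_zero_iff.2 h⟩

end Network

/-! ### The optimal input: equal marginal costs and total balance. -/

section OptimalInput

variable {V K : Type*} {N : FlowNetwork V K} (S : Spec N)

theorem Spec.Q_mulVec [DecidableEq V] (u : N.act → ℝ) (i : N.act) : (S.Q *ᵥ u) i = S.q i * u i :=
  mulVec_diagonal _ _ _

theorem Spec.inv_Q_mulVec [DecidableEq V] (u : N.act → ℝ) (i : N.act) :
    ((S.Q)⁻¹ *ᵥ u) i = u i / S.q i := by
  have hQ : (S.Q)⁻¹ = Matrix.diagonal fun i => (S.q i)⁻¹ := by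
    refine Matrix.inv_eq_right_inv ?_
    rw [Spec.Q, Matrix.diagonal_mul_diagonal, ← Matrix.diagonal_one]
    congr 1
    funext i
    exact mul_inv_cancel₀ (S.q_pos i).ne'
  rw [hQ, mulVec_diagonal, div_eq_inv_mul]

theorem Spec.sum_inv_q_pos (hact : N.act.Nonempty) : 0 < ∑ i, 1 / S.q i := by
  have : Nonempty N.act := hact.coe_sort
  exact Finset.sum_pos (fun i _ => one_div_pos.2 (S.q_pos i)) Finset.univ_nonempty

variable [Fintype V] [DecidableEq V]

/-- The common marginal cost of the optimal input. -/
noncomputable def Spec.marginalCost : ℝ := (∑ i, N.d i + ∑ j, S.r j / S.q j) / ∑ j, 1 / S.q j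

theorem Spec.kappa_apply (j : N.act) : S.kappa j = S.marginalCost := by
  have h : ∀ y : V → ℝ, vecMulVec (1 : V → ℝ) (1 : V → ℝ) *ᵥ y = fun _ => ∑ i, y i := by
    intro y
    funext i
    simp [mulVec, dotProduct, vecMulVec_apply]
  rw [Spec.kappa, N.transpose_E_mulVec, Pi.smul_apply, h, smul_eq_mul, ← div_eq_inv_mul,
    one_dotProduct, Spec.marginalCost]
  simp only [Pi.add_apply, Finset.sum_add_distrib, N.sum_E_mulVec, S.inv_Q_mulVec, Pi.one_apply]

theorem Spec.ubar_apply (j : N.act) : S.ubar j = (S.marginalCost - S.r j) / S.q j := by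
  rw [Spec.ubar, S.inv_Q_mulVec, Pi.sub_apply, S.kappa_apply]

theorem Spec.q_mul_ubar_add (j : N.act) : S.q j * S.ubar j + S.r j = S.marginalCost := by
  rw [S.ubar_apply, mul_div_cancel₀ _ (S.q_pos j).ne', sub_add_cancel]

theorem Spec.sum_ubar (hact : N.act.Nonempty) : ∑ j, S.ubar j = ∑ i, N.d i := by
  have h : ∀ j, S.ubar j = S.marginalCost * (1 / S.q j) - S.r j / S.q j := fun j => by
    rw [S.ubar_apply]; ring
  simp only [h, Finset.sum_sub_distrib, ← Finset.mul_sum]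
  rw [Spec.marginalCost, div_mul_cancel₀ _ (S.sum_inv_q_pos hact).ne', add_sub_cancel_right]

variable {S} in
-- Equal marginal costs leave one free parameter `c`. The total input is strictly increasing in it,
-- because its slope `∑ 1 / q` is positive.
theorem Spec.eq_ubar_of_sum_eq (hact : N.act.Nonempty) {u : N.act → ℝ} {c : ℝ}
    (hu : ∀ j, S.q j * u j + S.r j = c) (hsum : ∑ j, u j = ∑ i, N.d i) : u = S.ubar := by
  have h : ∀ j, u j - S.ubar j = (c - S.marginalCost) * (1 / S.q j) := by
    intro j
    have h1 : S.q j * (u j - S.ubar j) = c - S.marginalCost := by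
      linarith [hu j, S.q_mul_ubar_add j]
    rw [← h1]
    have := (S.q_pos j).ne'
    field_simp
  have h0 : (c - S.marginalCost) * ∑ j, 1 / S.q j = 0 := by
    rw [Finset.mul_sum, ← Finset.sum_congr rfl fun j _ => h j, Finset.sum_sub_distrib, hsum,
      S.sum_ubar hact, sub_self]
  have hc := (mul_eq_zero.1 h0).resolve_right (S.sum_inv_q_pos hact).ne'
  funext j
  have := h j
  rw [hc, zero_mul] at this
  linarith

/-- Second-order expansion at `ū`. The linear term is the common marginal cost times `∑ (u - ū)`,
which vanishes since both inputs balance the disturbance. -/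
theorem Spec.cost_eq (hact : N.act.Nonempty) {u : N.act → ℝ} (hu : ∑ j, u j = ∑ i, N.d i) :
    S.cost u = S.cost S.ubar + ∑ j, 1 / 2 * S.q j * (u j - S.ubar j) ^ 2 := by
  have h0 : ∑ j, S.marginalCost * (u j - S.ubar j) = 0 := by
    rw [← Finset.mul_sum, Finset.sum_sub_distrib, hu, S.sum_ubar hact, sub_self, mul_zero]
  rw [← add_zero (S.cost S.ubar + _), ← h0, Spec.cost, Spec.cost, ← Finset.sum_add_distrib,
    ← Finset.sum_add_distrib]
  refine Finset.sum_congr rfl fun j _ => ?_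
  rw [← S.q_mul_ubar_add j]
  ring

theorem Spec.isOptimalInput_iff [Fintype K] (hconn : N.graph.Connected) (hact : N.act.Nonempty)
    (u : N.act → ℝ) : S.IsOptimalInput u ↔ u = S.ubar := by
  have hq : ∀ (u : N.act → ℝ) j, 0 ≤ 1 / 2 * S.q j * (u j - S.ubar j) ^ 2 := fun u j => by
    have := S.q_pos j
    positivity
  obtain ⟨lam₀, hlam₀⟩ := FlowNetwork.exists_rhs_eq_zero hconn (S.sum_ubar hact)
  constructor
  · rintro ⟨⟨lam, hlam⟩, hmin⟩
    have h1 := hmin lam₀ _ hlam₀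
    rw [S.cost_eq hact (FlowNetwork.sum_eq_of_rhs_eq_zero hlam)] at h1
    have h2 : ∑ j, 1 / 2 * S.q j * (u j - S.ubar j) ^ 2 = 0 :=
      le_antisymm (by linarith) (Finset.sum_nonneg fun j _ => hq u j)
    funext j
    have h3 := (Finset.sum_eq_zero_iff_of_nonneg fun j _ => hq u j).1 h2 j (Finset.mem_univ j)
    have := S.q_pos j
    have h4 : (u j - S.ubar j) ^ 2 = 0 := by
      rcases mul_eq_zero.1 h3 with h | h
      · linarith
      · exact h
    exact sub_eq_zero.1 (pow_eq_zero_iff two_ne_zero |>.1 h4)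
  · rintro rfl
    refine ⟨⟨lam₀, hlam₀⟩, fun lam' u' h => ?_⟩
    rw [S.cost_eq hact (FlowNetwork.sum_eq_of_rhs_eq_zero h)]
    exact le_add_of_nonneg_right (Finset.sum_nonneg fun j _ => hq u' j)

end OptimalInput

/-! ### The Laplacian of a balanced, strongly connected digraph. -/

section Laplacian

variable {V K : Type*} {N : FlowNetwork V K} (C : Controller N)

theorem Controller.Lcom_mulVec [DecidableEq V] (v : N.act → ℝ) (i : N.act) :
    (C.Lcom *ᵥ v) i = ∑ j, C.weight i j * (v i - v j) := by
  rw [Controller.Lcom, sub_mulVec, Pi.sub_apply, mulVec_diagonal, Finset.sum_mul]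
  simp only [mulVec, dotProduct, of_apply, mul_sub, Finset.sum_sub_distrib]

theorem Controller.Lcom_mulVec_eq_zero [DecidableEq V] {v : N.act → ℝ} {c : ℝ} (hv : ∀ i, v i = c) :
    C.Lcom *ᵥ v = 0 := by
  funext i
  simp [C.Lcom_mulVec, hv]

variable {C}

/-- Balance in the form used below: row sums of the weights may be replaced by column sums. -/
theorem BalancedStronglyConnected.sum_sum_weight (hcom : BalancedStronglyConnected C)
    (a : N.act → ℝ) : ∑ i, ∑ j, C.weight i j * a j = ∑ i, ∑ j, C.weight i j * a i := by
  rw [Finset.sum_comm]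
  refine Finset.sum_congr rfl fun i _ => ?_
  rw [← Finset.sum_mul, ← Finset.sum_mul, hcom.balanced i]

variable [DecidableEq V]

theorem BalancedStronglyConnected.sum_Lcom_mulVec (hcom : BalancedStronglyConnected C)
    (v : N.act → ℝ) : ∑ i, (C.Lcom *ᵥ v) i = 0 := by
  simp only [C.Lcom_mulVec, mul_sub, Finset.sum_sub_distrib, hcom.sum_sum_weight, sub_self]

/-- Balance makes the two square terms contribute equally, so a Laplacian that need not be symmetric
still has a quadratic form of sum-of-squares type. -/
theorem BalancedStronglyConnected.dotProduct_Lcom_mulVec (hcom : BalancedStronglyConnected C)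
    (v : N.act → ℝ) :
    v ⬝ᵥ (C.Lcom *ᵥ v) = 1 / 2 * ∑ i, ∑ j, C.weight i j * (v i - v j) ^ 2 := by
  have h := hcom.sum_sum_weight fun i => v i ^ 2
  have h1 : ∑ i, ∑ j, C.weight i j * (v i - v j) ^ 2 =
      ∑ i, ∑ j, C.weight i j * v i ^ 2 + ∑ i, ∑ j, C.weight i j * v j ^ 2 -
        2 * ∑ i, ∑ j, C.weight i j * (v i * v j) := by
    simp only [Finset.mul_sum, ← Finset.sum_add_distrib, ← Finset.sum_sub_distrib]
    exact Finset.sum_congr rfl fun i _ => Finset.sum_congr rfl fun j _ => by ring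
  have h2 : v ⬝ᵥ (C.Lcom *ᵥ v) =
      ∑ i, ∑ j, C.weight i j * v i ^ 2 - ∑ i, ∑ j, C.weight i j * (v i * v j) := by
    simp only [dotProduct, C.Lcom_mulVec, Finset.mul_sum, ← Finset.sum_sub_distrib]
    exact Finset.sum_congr rfl fun i _ => Finset.sum_congr rfl fun j _ => by ring
  rw [h1, h2, h]
  ring

theorem BalancedStronglyConnected.dotProduct_Lcom_mulVec_nonneg
    (hcom : BalancedStronglyConnected C) (v : N.act → ℝ) : 0 ≤ v ⬝ᵥ (C.Lcom *ᵥ v) := by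
  rw [hcom.dotProduct_Lcom_mulVec]
  exact mul_nonneg (by norm_num) (Finset.sum_nonneg fun i _ => Finset.sum_nonneg fun j _ =>
    mul_nonneg (C.weight_nonneg i j) (sq_nonneg _))

/-- Every summand is nonnegative, hence zero, so `v` agrees across each link of positive weight and
therefore along directed paths. -/
theorem BalancedStronglyConnected.eq_of_dotProduct_Lcom_mulVec_eq_zero
    (hcom : BalancedStronglyConnected C) {v : N.act → ℝ} (hv : v ⬝ᵥ (C.Lcom *ᵥ v) = 0)
    (i j : N.act) : v i = v j := by
  have hnn : ∀ i j, 0 ≤ C.weight i j * (v i - v j) ^ 2 := fun i j =>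
    mul_nonneg (C.weight_nonneg i j) (sq_nonneg _)
  rw [hcom.dotProduct_Lcom_mulVec] at hv
  have h0 : ∑ i, ∑ j, C.weight i j * (v i - v j) ^ 2 = 0 := by linarith
  have h1 : ∀ i j, C.weight i j * (v i - v j) ^ 2 = 0 := fun i j =>
    (Finset.sum_eq_zero_iff_of_nonneg fun j _ => hnn i j).1
      ((Finset.sum_eq_zero_iff_of_nonneg fun i _ => Finset.sum_nonneg fun j _ => hnn i j).1 h0 i
        (Finset.mem_univ i)) j (Finset.mem_univ j)
  induction hcom.strong i j with
  | refl => rfl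
  | tail _ hw ih =>
    refine ih.trans (sub_eq_zero.1 ?_)
    exact pow_eq_zero_iff two_ne_zero |>.1 ((mul_eq_zero.1 (h1 _ _)).resolve_left hw.ne')

end Laplacian

/-! ### Locality of the controllers. -/

section Distributed

variable {V K : Type*} [Fintype V] [DecidableEq V] {N : FlowNetwork V K}
  (S : Spec N) (C : Controller N)

theorem Controller.isDistributed : C.IsDistributed S := by
  refine ⟨fun k y y' mu mu' xi xi' hp hn hmu hxi => ?_,
    fun i y y' theta theta' phi phi' hy htheta hphi hnbr => ?_⟩
  · have hf : C.flow mu k = C.flow mu' k := congrArg (C.f k) hmu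
    simp only [Controller.muRhs, Controller.xiRhs, Pi.sub_apply, N.transpose_B_mulVec, hp, hn, hf,
      hxi, and_self]
  · have hg : C.input theta i = C.input theta' i := congrArg (C.g i) htheta
    refine ⟨?_, ?_, hg⟩
    · simp only [Controller.thetaRhs, Pi.sub_apply, Pi.neg_apply, N.transpose_E_mulVec, hy, hg, hphi]
    · simp only [Controller.phiRhs, Pi.sub_apply, Pi.add_apply, S.Q_mulVec, C.Lcom_mulVec, hg, hphi]
      congr 2
      refine Finset.sum_congr rfl fun j _ => ?_
      rcases eq_or_ne (C.weight i j) 0 with h | h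
      · simp [h]
      · rw [hnbr j h]

end Distributed

/-! ### Equilibria are exactly the desired steady states. -/

section Equilibrium

theorem Lcom_mulVec_marginal_eq_zero {V K : Type*} [Fintype V] [DecidableEq V]
    {N : FlowNetwork V K} {S : Spec N} {C : Controller N} {phi : N.act → ℝ} (hphi : phi = S.ubar) :
    C.Lcom *ᵥ (S.Q *ᵥ phi + S.r) = 0 :=
  C.Lcom_mulVec_eq_zero (c := S.marginalCost) fun i => by
    rw [Pi.add_apply, S.Q_mulVec, hphi, S.q_mul_ubar_add]

variable {V K : Type*} [Fintype V] [DecidableEq V] [Fintype K] {N : FlowNetwork V K}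
  {S : Spec N} {C : Controller N}

theorem isEquilibrium_iff {e : State N} : IsEquilibrium S C e ↔
    N.rhs (C.flow (State.mu e)) (C.input (State.theta e)) = 0 ∧
    C.muRhs S (N.output (State.x e)) (State.mu e) (State.xi e) = 0 ∧
    C.xiRhs (State.mu e) (State.xi e) = 0 ∧
    C.thetaRhs S (N.output (State.x e)) (State.theta e) (State.phi e) = 0 ∧
    C.phiRhs S (State.theta e) (State.phi e) = 0 := by
  simp only [IsEquilibrium, vectorField, Prod.ext_iff, Prod.fst_zero, Prod.snd_zero, funext_iff,
    Pi.zero_apply, div_eq_zero_iff, (N.Tx_pos _).ne', (C.Tmu_pos _).ne', (C.Txi_pos _).ne',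
    (C.Ttheta_pos _).ne', (C.Tphi_pos _).ne', or_false]

/-- The desired steady-state conditions. -/
structure IsSteadyState (S : Spec N) (C : Controller N) (e : State N) : Prop where
  output_eq : N.output (State.x e) = S.ybar
  flow_eq : C.flow (State.mu e) = State.xi e
  input_eq : C.input (State.theta e) = S.ubar
  phi_eq : State.phi e = S.ubar
  rhs_eq : N.rhs (C.flow (State.mu e)) S.ubar = 0

theorem IsSteadyState.isEquilibrium {e : State N} (h : IsSteadyState S C e) :
    IsEquilibrium S C e := by
  rw [isEquilibrium_iff, h.input_eq]
  refine ⟨h.rhs_eq, ?_, ?_, ?_, ?_⟩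
  · rw [Controller.muRhs, h.output_eq, h.flow_eq, sub_self, mulVec_zero, sub_self, sub_self]
  · rw [Controller.xiRhs, h.flow_eq, sub_self]
  · rw [Controller.thetaRhs, h.output_eq, h.input_eq, h.phi_eq, sub_self, mulVec_zero, neg_zero,
      sub_self, sub_self]
  · rw [Controller.phiRhs, Lcom_mulVec_marginal_eq_zero h.phi_eq, h.input_eq, h.phi_eq, mulVec_zero,
      sub_self, sub_self]

/-- The output error is a constant `c` at all nodes. The Laplacian has zero column sums by balance,
which rules out `c ≠ 0`; then the marginal costs agree and the input is optimal. -/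
theorem IsEquilibrium.isSteadyState (hconn : N.graph.Connected) (hact : N.act.Nonempty)
    (hcom : BalancedStronglyConnected C) {e : State N} (he : IsEquilibrium S C e) :
    IsSteadyState S C e := by
  obtain ⟨hrhs, hmu, hxi, htheta, hphi⟩ := isEquilibrium_iff.1 he
  have hflow : C.flow (State.mu e) = State.xi e := sub_eq_zero.1 hxi
  have hB : (N.B)ᵀ *ᵥ (N.output (State.x e) - S.ybar) = 0 := by
    rwa [Controller.muRhs, hflow, sub_self, sub_zero] at hmu
  have hconst := FlowNetwork.eq_of_transpose_B_mulVec_eq_zero hconn hB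
  obtain ⟨j₀, hj₀⟩ := hact
  set c := (N.output (State.x e) - S.ybar) j₀ with hc
  set v := S.Q *ᵥ State.phi e + S.r with hv
  have hgphi : ∀ j, C.input (State.theta e) j - State.phi e j = -c := by
    intro j
    have h := congrFun htheta j
    rw [Controller.thetaRhs, Pi.sub_apply, Pi.neg_apply, N.transpose_E_mulVec, hconst j j₀] at h
    rw [← hc, Pi.sub_apply, Pi.zero_apply] at h
    linarith
  have hL : ∀ j, (C.Lcom *ᵥ v) j = -c * (1 / S.q j) := by
    intro j
    have h := congrFun hphi j
    rw [Controller.phiRhs, Pi.sub_apply, Pi.sub_apply, hgphi, S.Q_mulVec, Pi.zero_apply] at h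
    have := (S.q_pos j).ne'
    field_simp
    linarith
  -- Summing `hL` over the actuated nodes gives zero on the left and `-c` times the positive number
  -- `∑ 1 / q` on the right.
  have hc0 : c = 0 := by
    have h := hcom.sum_Lcom_mulVec v
    rw [Finset.sum_congr rfl fun j _ => hL j, ← Finset.mul_sum] at h
    exact neg_eq_zero.1 ((mul_eq_zero.1 h).resolve_right (S.sum_inv_q_pos ⟨j₀, hj₀⟩).ne')
  have hinput : C.input (State.theta e) = State.phi e := by
    funext j
    linarith [hgphi j]
  have hL0 : C.Lcom *ᵥ v = 0 := by
    funext j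
    rw [hL, hc0, neg_zero, zero_mul, Pi.zero_apply]
  have hv0 := hcom.eq_of_dotProduct_Lcom_mulVec_eq_zero (v := v) (by rw [hL0, dotProduct_zero])
  have hphibar : State.phi e = S.ubar := by
    refine Spec.eq_ubar_of_sum_eq ⟨j₀, hj₀⟩ (c := v ⟨j₀, hj₀⟩) (fun j => ?_) ?_
    · rw [← hv0 j, hv, Pi.add_apply, S.Q_mulVec]
    · rw [← hinput]
      exact FlowNetwork.sum_eq_of_rhs_eq_zero hrhs
  refine ⟨?_, hflow, hinput.trans hphibar, hphibar, ?_⟩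
  · funext i
    have h := hconst i j₀
    rw [← hc, hc0, Pi.sub_apply] at h
    linarith
  · rwa [hinput, hphibar] at hrhs

/-- The vector `Eū - d` has zero sum, so it equals `Bλ` for some `λ`. Then `BPB = B` shows that
`P(Eū - d) + (I - PB)ω` is also a flow routing it, and attainability realises that flow by `f`. -/
theorem exists_isSteadyState [DecidableEq K] (hconn : N.graph.Connected) (hact : N.act.Nonempty)
    (hset : FeasibleSetpoint S) (hatt : Attainable S C) : ∃ e : State N, IsSteadyState S C e := by
  obtain ⟨⟨P, hP, w, hf⟩, hg⟩ := hatt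
  choose x hx using hset
  choose mu hmu using hf
  choose theta htheta using hg
  refine ⟨(x, mu, C.flow mu, theta, S.ubar), funext hx, rfl, funext htheta, rfl, ?_⟩
  have hflow : C.flow mu = P *ᵥ (N.E *ᵥ S.ubar - N.d) + (1 - P * N.B : Matrix K K ℝ) *ᵥ w :=
    funext hmu
  obtain ⟨lam, hlam⟩ := FlowNetwork.exists_rhs_eq_zero hconn (S.sum_ubar hact)
  rw [FlowNetwork.rhs_eq_zero_iff] at hlam ⊢
  rw [hflow, mulVec_add, mulVec_mulVec, mulVec_mulVec, Matrix.mul_sub, Matrix.mul_one,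
    ← Matrix.mul_assoc, hP.mul_mul_self, sub_self, zero_mulVec, add_zero, ← hlam, mulVec_mulVec,
    hP.mul_mul_self]

theorem IsSteadyState.of_mem_Upsilon {e z : State N} (he : IsSteadyState S C e)
    (hz : z ∈ Upsilon C e) :
    N.output (State.x z) = S.ybar ∧ C.input (State.theta z) = S.ubar := by
  obtain ⟨-, -, hx, htheta, -⟩ := hz
  rw [hx, htheta]
  exact ⟨he.output_eq, he.input_eq⟩

/-- Steady states share output and input, hence `x` and `θ` by injectivity of `h` and `g`. Their
flows solve the same linear system, so they differ by an element of the kernel of `B`. -/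
theorem IsSteadyState.mem_Upsilon (hout : AdmissibleOutputs S C) {e z : State N}
    (he : IsSteadyState S C e) (hz : IsSteadyState S C z) : z ∈ Upsilon C e := by
  have hB : N.B *ᵥ (C.flow (State.mu z) - C.flow (State.mu e)) = 0 := by
    rw [mulVec_sub, FlowNetwork.rhs_eq_zero_iff.1 hz.rhs_eq,
      FlowNetwork.rhs_eq_zero_iff.1 he.rhs_eq, sub_self]
  refine ⟨hB, ?_, ?_, ?_, hz.phi_eq.trans he.phi_eq.symm⟩
  · rwa [← hz.flow_eq, ← he.flow_eq]
  · exact N.output_injective (hz.output_eq.trans he.output_eq.symm)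
  · exact funext fun i => (hout.g_strictMono i).injective
      (congrFun (hz.input_eq.trans he.input_eq.symm) i)

end Equilibrium

/-! ### The closed-loop vector field is `C¹`. -/

section Smoothness

variable {V K : Type*} [Fintype V] [DecidableEq V] [Fintype K] {N : FlowNetwork V K}
  {S : Spec N} {C : Controller N}

theorem contDiff_componentwise {ι : Type*} [Fintype ι] {n : WithTop ℕ∞} {φ : ι → ℝ → ℝ}
    (hφ : ∀ i, ContDiff ℝ n (φ i)) : ContDiff ℝ n fun (z : ι → ℝ) i => φ i (z i) :=
  contDiff_pi.2 fun i => (hφ i).comp (contDiff_apply ℝ ℝ i)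

theorem ContDiff.mulVec {ι κ X : Type*} [Fintype ι] [Fintype κ] [NormedAddCommGroup X]
    [NormedSpace ℝ X] {n : WithTop ℕ∞} (A : Matrix ι κ ℝ) {φ : X → κ → ℝ} (hφ : ContDiff ℝ n φ) :
    ContDiff ℝ n fun z => A *ᵥ φ z :=
  (LinearMap.toContinuousLinearMap (Matrix.mulVecLin A)).contDiff.comp hφ

theorem ContDiff.pi_div_const {ι X : Type*} [Fintype ι] [NormedAddCommGroup X]
    [NormedSpace ℝ X] {n : WithTop ℕ∞} {φ : X → ι → ℝ} (hφ : ContDiff ℝ n φ) (T : ι → ℝ) :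
    ContDiff ℝ n fun z i => φ z i / T i :=
  contDiff_pi.2 fun i => (contDiff_pi.1 hφ i).div_const (T i)

theorem contDiff_vectorField (hout : AdmissibleOutputs S C) :
    ContDiff ℝ 1 (vectorField S C) := by
  have hx : ContDiff ℝ 1 fun z : State N => State.x z := contDiff_fst
  have hmu : ContDiff ℝ 1 fun z : State N => State.mu z := contDiff_fst.comp contDiff_snd
  have hxi : ContDiff ℝ 1 fun z : State N => State.xi z :=
    contDiff_fst.comp (contDiff_snd.comp contDiff_snd)
  have htheta : ContDiff ℝ 1 fun z : State N => State.theta z :=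
    contDiff_fst.comp (contDiff_snd.comp (contDiff_snd.comp contDiff_snd))
  have hphi : ContDiff ℝ 1 fun z : State N => State.phi z :=
    contDiff_snd.comp (contDiff_snd.comp (contDiff_snd.comp contDiff_snd))
  have hy : ContDiff ℝ 1 fun z : State N => N.output (State.x z) :=
    (contDiff_componentwise N.h_contDiff).comp hx
  have hf : ContDiff ℝ 1 fun z : State N => C.flow (State.mu z) :=
    (contDiff_componentwise hout.f_contDiff).comp hmu
  have hg : ContDiff ℝ 1 fun z : State N => C.input (State.theta z) :=
    (contDiff_componentwise hout.g_contDiff).comp htheta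
  have hQ := (hphi.mulVec S.Q).add (contDiff_const (c := S.r))
  exact ((((hf.mulVec N.B).neg.add (hg.mulVec N.E)).sub contDiff_const).pi_div_const N.Tx).prodMk
    (((((hy.sub contDiff_const).mulVec (N.B)ᵀ).sub (hf.sub hxi)).pi_div_const C.Tmu).prodMk
    (((hf.sub hxi).pi_div_const C.Txi).prodMk
    (((((hy.sub contDiff_const).mulVec (N.E)ᵀ).neg.sub (hg.sub hphi)).pi_div_const
      C.Ttheta).prodMk
    (((hg.sub hphi).sub ((hQ.mulVec C.Lcom).mulVec S.Q)).pi_div_const C.Tphi))))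

end Smoothness

/-! ### The energy and its dissipation. -/

section LyapunovFunction

variable {V K : Type*} [Fintype V] [Fintype K] {N : FlowNetwork V K}

/-- The energy of the closed loop relative to `e`. -/
noncomputable def energy (C : Controller N) (e z : State N) : ℝ :=
  sumPotential N.Tx N.h (State.x e) (State.x z) +
    (sumPotential C.Tmu C.f (State.mu e) (State.mu z) +
      (sumPotential C.Txi (fun _ a => a) (State.xi e) (State.xi z) +
        (sumPotential C.Ttheta C.g (State.theta e) (State.theta z) +
          sumPotential C.Tphi (fun _ a => a) (State.phi e) (State.phi z))))

/-- The derivative of the energy. -/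
noncomputable def energyDeriv (C : Controller N) (e z : State N) : State N →L[ℝ] ℝ :=
  (sumPotentialDeriv N.Tx N.h (State.x e) (State.x z)).comp (.fst ℝ _ _) +
    ((sumPotentialDeriv C.Tmu C.f (State.mu e) (State.mu z)).comp (.fst ℝ _ _) +
      ((sumPotentialDeriv C.Txi (fun _ a => a) (State.xi e) (State.xi z)).comp (.fst ℝ _ _) +
        ((sumPotentialDeriv C.Ttheta C.g (State.theta e) (State.theta z)).comp (.fst ℝ _ _) +
          (sumPotentialDeriv C.Tphi (fun _ a => a) (State.phi e) (State.phi z)).comp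
            (.snd ℝ _ _)).comp (.snd ℝ _ _)).comp (.snd ℝ _ _)).comp (.snd ℝ _ _)

theorem energy_self (C : Controller N) (e : State N) : energy C e e = 0 := by
  simp [energy, sumPotential_self]

theorem hasFDerivAt_energy {S : Spec N} {C : Controller N} (hout : AdmissibleOutputs S C)
    (e z : State N) : HasFDerivAt (energy C e) (energyDeriv C e z) z := by
  have hx := hasFDerivAt_sumPotential (fun i => (N.h_contDiff i).continuous) N.Tx
    (State.x e) (State.x z)
  have hmu := hasFDerivAt_sumPotential (fun i => (hout.f_contDiff i).continuous) C.Tmu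
    (State.mu e) (State.mu z)
  have hxi := hasFDerivAt_sumPotential (φ := fun _ a => a) (fun _ => continuous_id) C.Txi
    (State.xi e) (State.xi z)
  have htheta := hasFDerivAt_sumPotential (fun i => (hout.g_contDiff i).continuous) C.Ttheta
    (State.theta e) (State.theta z)
  have hphi := hasFDerivAt_sumPotential (φ := fun _ a => a) (fun _ => continuous_id) C.Tphi
    (State.phi e) (State.phi z)
  have h4 := hasFDerivAt_add_prod (z := z.2.2.2) htheta hphi
  have h3 := hasFDerivAt_add_prod (z := z.2.2) hxi h4
  have h2 := hasFDerivAt_add_prod (z := z.2) hmu h3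
  exact hasFDerivAt_add_prod (z := z) hx h2

theorem hasLinearGrowth_energy {S : Spec N} {C : Controller N} (hout : AdmissibleOutputs S C)
    (e : State N) : HasLinearGrowth (energy C e) e := by
  have hx := hasLinearGrowth_sumPotential N.Tx_pos (fun i => (N.h_contDiff i).continuous)
    N.h_strictMono (State.x e)
  have hmu := hasLinearGrowth_sumPotential C.Tmu_pos (fun i => (hout.f_contDiff i).continuous)
    hout.f_strictMono (State.mu e)
  have hxi := hasLinearGrowth_sumPotential C.Txi_pos (fun _ => continuous_id)
    (fun _ => strictMono_id) (State.xi e)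
  have htheta := hasLinearGrowth_sumPotential C.Ttheta_pos
    (fun i => (hout.g_contDiff i).continuous) hout.g_strictMono (State.theta e)
  have hphi := hasLinearGrowth_sumPotential C.Tphi_pos (fun _ => continuous_id)
    (fun _ => strictMono_id) (State.phi e)
  refine hx.prodMk (hmu.prodMk (hxi.prodMk (htheta.prodMk hphi ?_ ?_) ?_ ?_) ?_ ?_) ?_ ?_ <;>
    simp [sumPotential_self]

variable [DecidableEq V] {S : Spec N} {C : Controller N}

/-- The terms in `B` from the `x`- and `μ`-equations cancel, and likewise those in `E` from the `x`-
and `θ`-equations. Since `f(μ)` and `ξ` have the same steady value, their two terms combine to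
`-|f(μ) - ξ|²`; the same holds for `g(θ)` and `φ`. -/
theorem energyDeriv_vectorField {e : State N} (he : IsSteadyState S C e) (z : State N) :
    energyDeriv C e z (vectorField S C z) =
      -∑ k, (C.flow (State.mu z) - State.xi z) k ^ 2 -
        ∑ i, (C.input (State.theta z) - State.phi z) i ^ 2 -
        (S.Q *ᵥ (State.phi z - S.ubar)) ⬝ᵥ (C.Lcom *ᵥ (S.Q *ᵥ (State.phi z - S.ubar))) := by
  obtain ⟨x, mu, xi, theta, phi⟩ := z
  -- The marginal costs at `ū` are all equal, so the Laplacian kills `Qū + r`, which may be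
  -- subtracted.
  have hL : C.Lcom *ᵥ (S.Q *ᵥ phi + S.r) = C.Lcom *ᵥ (S.Q *ᵥ (phi - S.ubar)) := by
    have h := Lcom_mulVec_marginal_eq_zero (C := C) (rfl : S.ubar = S.ubar)
    rw [← sub_zero (C.Lcom *ᵥ _), ← h, ← mulVec_sub, add_sub_add_right_eq_sub, ← mulVec_sub]
  set y := N.output x - S.ybar with hy
  set f := C.flow mu with hf
  set g := C.input theta with hg
  set p := phi - S.ubar with hp
  set l := C.Lcom *ᵥ (S.Q *ᵥ p) with hl
  have hx' : ∑ i, (N.h i (x i) - N.h i (State.x e i)) * N.rhs f g i =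
      -(y ⬝ᵥ (N.B *ᵥ (f - C.flow (State.mu e)))) + y ⬝ᵥ (N.E *ᵥ (g - S.ubar)) := by
    have h1 : ∀ i, N.h i (x i) - N.h i (State.x e i) = y i := fun i => by
      rw [hy, ← he.output_eq]; rfl
    have h2 : N.rhs f g = -(N.B *ᵥ (f - C.flow (State.mu e))) + N.E *ᵥ (g - S.ubar) := by
      have h := he.rhs_eq
      rw [← sub_zero (N.rhs f g), ← h]
      simp only [FlowNetwork.rhs, mulVec_sub]
      abel
    simp only [h1]
    rw [← dotProduct_neg, ← dotProduct_add, ← h2]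
    rfl
  have hmu' : ∑ k, (C.f k (mu k) - C.f k (State.mu e k)) * C.muRhs S (N.output x) mu xi k =
      ((N.B)ᵀ *ᵥ y) ⬝ᵥ (f - C.flow (State.mu e)) -
        (f - C.flow (State.mu e)) ⬝ᵥ (f - xi) := by
    rw [dotProduct_comm, ← dotProduct_sub]
    rfl
  have hxi' : ∑ k, (xi k - State.xi e k) * C.xiRhs mu xi k = (xi - State.xi e) ⬝ᵥ (f - xi) := rfl
  have htheta' : ∑ i, (C.g i (theta i) - C.g i (State.theta e i)) *
      C.thetaRhs S (N.output x) theta phi i =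
      -(((N.E)ᵀ *ᵥ y) ⬝ᵥ (g - S.ubar)) - (g - S.ubar) ⬝ᵥ (g - phi) := by
    rw [dotProduct_comm, ← dotProduct_neg, ← dotProduct_sub, ← he.input_eq]
    rfl
  have hphi' : ∑ i, (phi i - State.phi e i) * C.phiRhs S theta phi i =
      p ⬝ᵥ (g - phi) - (S.Q *ᵥ p) ⬝ᵥ l := by
    have h1 : (S.Q *ᵥ p) ⬝ᵥ l = p ⬝ᵥ (S.Q *ᵥ l) := by
      rw [dotProduct_mulVec p, ← mulVec_transpose, Spec.Q, diagonal_transpose]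
    rw [h1, ← dotProduct_sub, ← hL, hp, ← he.phi_eq]
    rfl
  have hsplit : energyDeriv C e (x, mu, xi, theta, phi) (vectorField S C (x, mu, xi, theta, phi)) =
      ∑ i, (N.h i (x i) - N.h i (State.x e i)) * N.rhs f g i +
      (∑ k, (C.f k (mu k) - C.f k (State.mu e k)) * C.muRhs S (N.output x) mu xi k +
      (∑ k, (xi k - State.xi e k) * C.xiRhs mu xi k +
      (∑ i, (C.g i (theta i) - C.g i (State.theta e i)) *
        C.thetaRhs S (N.output x) theta phi i +
      ∑ i, (phi i - State.phi e i) * C.phiRhs S theta phi i))) := by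
    rw [← sumPotentialDeriv_div N.Tx_pos, ← sumPotentialDeriv_div C.Tmu_pos,
      ← sumPotentialDeriv_div C.Txi_pos (fun _ a => a), ← sumPotentialDeriv_div C.Ttheta_pos,
      ← sumPotentialDeriv_div C.Tphi_pos (fun _ a => a)]
    rfl
  rw [hsplit, hx', hmu', hxi', htheta', hphi', N.dotProduct_B_mulVec, N.dotProduct_E_mulVec,
    he.flow_eq, Finset.sum_congr rfl fun k _ => sq _, Finset.sum_congr rfl fun i _ => sq _]
  change _ = -((f - xi) ⬝ᵥ (f - xi)) - (g - phi) ⬝ᵥ (g - phi) - _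
  have h1 : (f - State.xi e) ⬝ᵥ (f - xi) =
      (f - xi) ⬝ᵥ (f - xi) + (xi - State.xi e) ⬝ᵥ (f - xi) := by
    rw [← add_dotProduct, sub_add_sub_cancel]
  have h2 : (g - S.ubar) ⬝ᵥ (g - phi) = (g - phi) ⬝ᵥ (g - phi) + p ⬝ᵥ (g - phi) := by
    rw [← add_dotProduct, sub_add_sub_cancel]
  rw [h1, h2]
  ring

theorem energyDeriv_vectorField_nonpos (hcom : BalancedStronglyConnected C) {e : State N}
    (he : IsSteadyState S C e) (z : State N) : energyDeriv C e z (vectorField S C z) ≤ 0 := by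
  rw [energyDeriv_vectorField he]
  have h1 : 0 ≤ ∑ k, (C.flow (State.mu z) - State.xi z) k ^ 2 :=
    Finset.sum_nonneg fun k _ => sq_nonneg _
  have h2 : 0 ≤ ∑ i, (C.input (State.theta z) - State.phi z) i ^ 2 :=
    Finset.sum_nonneg fun i _ => sq_nonneg _
  linarith [hcom.dotProduct_Lcom_mulVec_nonneg (S.Q *ᵥ (State.phi z - S.ubar))]

/-- All three dissipation terms vanish. The third one makes `Q(φ - ū)` constant across nodes, hence
also the marginal costs `Qφ + r`, so the consensus term disappears. -/
theorem xiRhs_and_phiRhs_eq_zero (hcom : BalancedStronglyConnected C) {e z : State N}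
    (he : IsSteadyState S C e) (h : energyDeriv C e z (vectorField S C z) = 0) :
    C.xiRhs (State.mu z) (State.xi z) = 0 ∧ C.input (State.theta z) = State.phi z ∧
      C.phiRhs S (State.theta z) (State.phi z) = 0 := by
  rw [energyDeriv_vectorField he] at h
  have h1 : 0 ≤ ∑ k, (C.flow (State.mu z) - State.xi z) k ^ 2 :=
    Finset.sum_nonneg fun k _ => sq_nonneg _
  have h2 : 0 ≤ ∑ i, (C.input (State.theta z) - State.phi z) i ^ 2 :=
    Finset.sum_nonneg fun i _ => sq_nonneg _
  have h3 := hcom.dotProduct_Lcom_mulVec_nonneg (S.Q *ᵥ (State.phi z - S.ubar))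
  have hinput : C.input (State.theta z) - State.phi z = 0 := by
    refine funext fun i => pow_eq_zero_iff two_ne_zero |>.1
      ((Finset.sum_eq_zero_iff_of_nonneg fun i _ => sq_nonneg _).1 ?_ i (Finset.mem_univ i))
    linarith
  refine ⟨?_, sub_eq_zero.1 hinput, ?_⟩
  · refine funext fun k => pow_eq_zero_iff two_ne_zero |>.1
      ((Finset.sum_eq_zero_iff_of_nonneg fun k _ => sq_nonneg _).1 ?_ k (Finset.mem_univ k))
    change ∑ k, (C.flow (State.mu z) - State.xi z) k ^ 2 = 0
    linarith
  · have hconst := hcom.eq_of_dotProduct_Lcom_mulVec_eq_zero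
      (v := S.Q *ᵥ (State.phi z - S.ubar)) (by linarith)
    have hL : C.Lcom *ᵥ (S.Q *ᵥ State.phi z + S.r) = 0 := by
      -- An actuated node is needed only to name the common value; without one the vectors are
      -- empty.
      rcases isEmpty_or_nonempty N.act with hE | ⟨⟨j₀⟩⟩
      · exact funext fun j => isEmptyElim j
      · refine C.Lcom_mulVec_eq_zero
          (c := (S.Q *ᵥ (State.phi z - S.ubar)) j₀ + S.marginalCost) fun i => ?_
        rw [hconst j₀ i, ← S.q_mul_ubar_add i, Pi.add_apply, S.Q_mulVec, S.Q_mulVec, Pi.sub_apply]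
        ring
    rw [Controller.phiRhs, hinput, hL, mulVec_zero, sub_zero]

end LyapunovFunction

/-! ### Linear observables that are constant along a solution. -/

section Invariance

variable {X F : Type*} [NormedAddCommGroup X] [NormedSpace ℝ X] [NormedAddCommGroup F]
  [NormedSpace ℝ F] {v : X → X} {y : ℝ → X}

theorem apply_eq_apply_zero_of_isIntegralCurveOn
    (hy : IsIntegralCurveOn y (fun _ => v) (Set.Ici 0)) (l : X →L[ℝ] F)
    (hl : ∀ s, 0 ≤ s → l (v (y s)) = 0) {s : ℝ} (hs : 0 ≤ s) : l (y s) = l (y 0) := by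
  have hd : ∀ t ∈ Set.Ici (0 : ℝ), HasDerivWithinAt (fun t => l (y t)) 0 (Set.Ici 0) t := by
    intro t ht
    have h := l.hasFDerivAt.comp_hasDerivWithinAt t (hy t ht)
    rwa [hl t ht] at h
  exact (convex_Ici (0 : ℝ)).is_const_of_fderivWithin_eq_zero (𝕜 := ℝ)
    (fun t ht => (hd t ht).differentiableWithinAt) (fun t ht => by
      simpa using (hd t ht).hasFDerivWithinAt.fderivWithin (uniqueDiffOn_Ici 0 t ht))
    hs (Set.mem_Ici.2 le_rfl)

theorem apply_vectorField_eq_zero_of_isIntegralCurveOn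
    (hy : IsIntegralCurveOn y (fun _ => v) (Set.Ici 0)) (l : X →L[ℝ] F)
    (hl : ∀ s, 0 ≤ s → l (y s) = l (y 0)) {s : ℝ} (hs : 0 ≤ s) : l (v (y s)) = 0 :=
  (uniqueDiffOn_Ici 0 s hs).eq_deriv _ (l.hasFDerivAt.comp_hasDerivWithinAt s (hy s hs))
    ((hasDerivWithinAt_const s _ (l (y 0))).congr hl (hl s hs))

end Invariance

/-! ### The invariant set without dissipation, and convergence. -/

section Convergence

variable {V K : Type*} [Fintype V] [DecidableEq V] [Fintype K] {N : FlowNetwork V K}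
  {S : Spec N} {C : Controller N}

/-- Zero dissipation freezes `ξ` and `φ`, and through `f(μ) = ξ` and `g(θ) = φ` also `μ` and `θ`.
Frozen controllers force zero output error, which freezes `x`. -/
theorem isEquilibrium_of_energyDeriv_eq_zero (hconn : N.graph.Connected) (hact : N.act.Nonempty)
    (hcom : BalancedStronglyConnected C) (hout : AdmissibleOutputs S C) {e : State N}
    (he : IsSteadyState S C e) {y : ℝ → State N} (hy : IsSolutionOn S C y (Set.Ici 0))
    (h : ∀ s, 0 ≤ s → energyDeriv C e (y s) (vectorField S C (y s)) = 0) :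
    IsEquilibrium S C (y 0) := by
  let lx : State N →L[ℝ] (V → ℝ) := .fst ℝ _ _
  let lmu : State N →L[ℝ] (K → ℝ) := (ContinuousLinearMap.fst ℝ _ _).comp (.snd ℝ _ _)
  let lxi : State N →L[ℝ] (K → ℝ) :=
    (ContinuousLinearMap.fst ℝ _ _).comp ((ContinuousLinearMap.snd ℝ _ _).comp (.snd ℝ _ _))
  let ltheta : State N →L[ℝ] (N.act → ℝ) := (ContinuousLinearMap.fst ℝ _ _).comp
    ((ContinuousLinearMap.snd ℝ _ _).comp ((ContinuousLinearMap.snd ℝ _ _).comp (.snd ℝ _ _)))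
  let lphi : State N →L[ℝ] (N.act → ℝ) := (ContinuousLinearMap.snd ℝ _ _).comp
    ((ContinuousLinearMap.snd ℝ _ _).comp ((ContinuousLinearMap.snd ℝ _ _).comp (.snd ℝ _ _)))
  have hdiss := fun (s : ℝ) (hs : 0 ≤ s) => xiRhs_and_phiRhs_eq_zero hcom he (h s hs)
  have hflow : ∀ s, 0 ≤ s → C.flow (State.mu (y s)) = State.xi (y s) := fun s hs =>
    sub_eq_zero.1 (hdiss s hs).1
  have hxi : ∀ s, 0 ≤ s → State.xi (y s) = State.xi (y 0) := fun s hs =>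
    apply_eq_apply_zero_of_isIntegralCurveOn hy lxi
      (fun s hs => funext fun k => by
        change C.xiRhs _ _ k / _ = 0
        rw [(hdiss s hs).1, Pi.zero_apply, zero_div]) hs
  have hphi : ∀ s, 0 ≤ s → State.phi (y s) = State.phi (y 0) := fun s hs =>
    apply_eq_apply_zero_of_isIntegralCurveOn hy lphi
      (fun s hs => funext fun k => by
        change C.phiRhs S _ _ k / _ = 0
        rw [(hdiss s hs).2.2, Pi.zero_apply, zero_div]) hs
  have hmu : ∀ s, 0 ≤ s → State.mu (y s) = State.mu (y 0) := fun s hs => funext fun k =>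
    (hout.f_strictMono k).injective (congrFun
      ((hflow s hs).trans ((hxi s hs).trans (hflow 0 le_rfl).symm)) k)
  have htheta : ∀ s, 0 ≤ s → State.theta (y s) = State.theta (y 0) := fun s hs => funext fun k =>
    (hout.g_strictMono k).injective (congrFun
      ((hdiss s hs).2.1.trans ((hphi s hs).trans (hdiss 0 le_rfl).2.1.symm)) k)
  have hmuRhs : ∀ s, 0 ≤ s →
      C.muRhs S (N.output (State.x (y s))) (State.mu (y s)) (State.xi (y s)) = 0 := by
    intro s hs
    have h0 := apply_vectorField_eq_zero_of_isIntegralCurveOn hy lmu hmu hs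
    exact funext fun k => (div_eq_zero_iff.1 (congrFun h0 k)).resolve_right (C.Tmu_pos k).ne'
  have hthetaRhs : ∀ s, 0 ≤ s →
      C.thetaRhs S (N.output (State.x (y s))) (State.theta (y s)) (State.phi (y s)) = 0 := by
    intro s hs
    have h0 := apply_vectorField_eq_zero_of_isIntegralCurveOn hy ltheta htheta hs
    exact funext fun k => (div_eq_zero_iff.1 (congrFun h0 k)).resolve_right (C.Ttheta_pos k).ne'
  have houtput : ∀ s, 0 ≤ s → N.output (State.x (y s)) = S.ybar := by
    intro s hs
    refine sub_eq_zero.1 (FlowNetwork.eq_zero_of_transpose_mulVec_eq_zero hconn hact ?_ ?_)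
    · have h1 := hmuRhs s hs
      rwa [Controller.muRhs, hflow s hs, sub_self, sub_zero] at h1
    · have h1 := hthetaRhs s hs
      rwa [Controller.thetaRhs, (hdiss s hs).2.1, sub_self, sub_zero, neg_eq_zero] at h1
  have hx : ∀ s, 0 ≤ s → State.x (y s) = State.x (y 0) := fun s hs =>
    N.output_injective ((houtput s hs).trans (houtput 0 le_rfl).symm)
  have hrhs : N.rhs (C.flow (State.mu (y 0))) (C.input (State.theta (y 0))) = 0 := by
    have h0 := apply_vectorField_eq_zero_of_isIntegralCurveOn hy lx hx le_rfl
    exact funext fun i => (div_eq_zero_iff.1 (congrFun h0 i)).resolve_right (N.Tx_pos i).ne'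
  exact isEquilibrium_iff.2 ⟨hrhs, hmuRhs 0 le_rfl, (hdiss 0 le_rfl).1, hthetaRhs 0 le_rfl,
    (hdiss 0 le_rfl).2.2⟩

theorem exists_tendsto_isEquilibrium (hconn : N.graph.Connected) (hact : N.act.Nonempty)
    (hcom : BalancedStronglyConnected C) (hout : AdmissibleOutputs S C) {e : State N}
    (he : IsSteadyState S C e) {z : ℝ → State N} (hz : IsSolutionOn S C z (Set.Ici 0)) :
    ∃ p, IsEquilibrium S C p ∧ Tendsto z atTop (𝓝 p) :=
  exists_tendsto_equilibrium (contDiff_vectorField hout) (hasFDerivAt_energy hout) (energy_self C)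
    (fun _ h => energyDeriv_vectorField_nonpos hcom
      (IsEquilibrium.isSteadyState hconn hact hcom h))
    (hasLinearGrowth_energy hout) he.isEquilibrium
    (fun _ hy h => isEquilibrium_of_energyDeriv_eq_zero hconn hact hcom hout he hy h) hz

theorem exists_unique_solution (hcom : BalancedStronglyConnected C)
    (hout : AdmissibleOutputs S C) {e : State N} (he : IsSteadyState S C e) (z₀ : State N) :
    ∃ z : ℝ → State N, IsSolutionOn S C z (Set.Ici 0) ∧ z 0 = z₀ ∧
      ∀ (T : ℝ) (w : ℝ → State N), 0 < T → IsSolutionOn S C w (Set.Ico 0 T) → w 0 = z₀ →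
        Set.EqOn w z (Set.Ico 0 T) := by
  obtain ⟨z, hz, hz0⟩ := exists_isIntegralCurveOn_Ici (contDiff_vectorField hout)
    (hasFDerivAt_energy hout e) (energyDeriv_vectorField_nonpos hcom he)
    (hasLinearGrowth_energy hout e) z₀
  exact ⟨z, hz, hz0, fun T w _ hw hw0 => eqOn_Ico_of_isIntegralCurveOn (contDiff_vectorField hout)
    hw (hz.mono Set.Ico_subset_Ici_self) (hw0.trans hz0.symm)⟩

end Convergence

end FlowRegulation


theorem theorem1 {V K : Type*} [Fintype V] [DecidableEq V] [Fintype K] [DecidableEq K]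
    (N : FlowNetwork V K) (S : Spec N) (C : Controller N)
    (hconn : N.graph.Connected)
    (hact : N.act.Nonempty)
    (hset : FeasibleSetpoint S)
    (hcom : BalancedStronglyConnected C)
    (hatt : Attainable S C)
    (hout : AdmissibleOutputs S C) :
    -- `ū` is the unique optimal input
    (∀ u : N.act → ℝ, S.IsOptimalInput u ↔ u = S.ubar) ∧
    -- the controllers are distributed
    C.IsDistributed S ∧
    -- an equilibrium exists
    (∃ e : State N, IsEquilibrium S C e) ∧
    -- every initial state has a solution on `[0, ∞)`, and all solutions from it are part of it
    (∀ z₀ : State N, ∃ z : ℝ → State N, IsSolutionOn S C z (Set.Ici 0) ∧ z 0 = z₀ ∧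
      ∀ (T : ℝ) (w : ℝ → State N), 0 < T → IsSolutionOn S C w (Set.Ico 0 T) → w 0 = z₀ →
        Set.EqOn w z (Set.Ico 0 T)) ∧
    -- for every equilibrium `e`, the outputs and inputs are as desired on the set `Υ₁`, and every
    -- solution converges to a point of `Υ₁`, which is an equilibrium
    (∀ e : State N, IsEquilibrium S C e →
      (∀ z ∈ Upsilon C e,
        N.output (State.x z) = S.ybar ∧ C.input (State.theta z) = S.ubar) ∧
      ∀ z : ℝ → State N, IsSolutionOn S C z (Set.Ici 0) →
        ∃ zInf ∈ Upsilon C e, IsEquilibrium S C zInf ∧ Tendsto z atTop (𝓝 zInf) ∧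
          Tendsto (fun t => C.flow (State.mu (z t))) atTop (𝓝 (C.flow (State.mu zInf)))) ∧
    -- output regulation, optimal feedforward input, and the constraints for all `t ≥ 0`
    (∀ z : ℝ → State N, IsSolutionOn S C z (Set.Ici 0) →
      Tendsto (fun t => N.output (State.x (z t))) atTop (𝓝 S.ybar) ∧
      Tendsto (fun t => C.input (State.theta (z t))) atTop (𝓝 S.ubar) ∧
      ∀ t : ℝ, 0 ≤ t →
        (∀ k, S.flowLo k < (C.flow (State.mu (z t)) k : EReal) ∧
          (C.flow (State.mu (z t)) k : EReal) < S.flowHi k) ∧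
        (∀ i, S.inputLo i < (C.input (State.theta (z t)) i : EReal) ∧
          (C.input (State.theta (z t)) i : EReal) < S.inputHi i)) := by
  obtain ⟨e₀, he₀⟩ := exists_isSteadyState hconn hact hset hatt
  have hsteady : ∀ {e : State N}, IsEquilibrium S C e → IsSteadyState S C e :=
    fun he => IsEquilibrium.isSteadyState hconn hact hcom he
  have hxc : Continuous fun z : State N => N.output (State.x z) :=
    (contDiff_componentwise N.h_contDiff).continuous.comp (by fun_prop)
  have hfc : Continuous fun z : State N => C.flow (State.mu z) :=
    (contDiff_componentwise hout.f_contDiff).continuous.comp (by fun_prop)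
  have hgc : Continuous fun z : State N => C.input (State.theta z) :=
    (contDiff_componentwise hout.g_contDiff).continuous.comp (by fun_prop)
  refine ⟨S.isOptimalInput_iff hconn hact, C.isDistributed S, ⟨e₀, he₀.isEquilibrium⟩,
    exists_unique_solution hcom hout he₀, fun e he => ⟨fun z hz => (hsteady he).of_mem_Upsilon hz,
      fun z hz => ?_⟩, fun z hz => ?_⟩
  · obtain ⟨p, hp, hlim⟩ := exists_tendsto_isEquilibrium hconn hact hcom hout (hsteady he) hz
    exact ⟨p, (hsteady he).mem_Upsilon hout (hsteady hp), hp, hlim, (hfc.tendsto p).comp hlim⟩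
  · obtain ⟨p, hp, hlim⟩ := exists_tendsto_isEquilibrium hconn hact hcom hout he₀ hz
    refine ⟨?_, ?_, fun t _ => ⟨fun k => ?_, fun i => ?_⟩⟩
    · rw [← (hsteady hp).output_eq]
      exact (hxc.tendsto p).comp hlim
    · rw [← (hsteady hp).input_eq]
      exact (hgc.tendsto p).comp hlim
    -- The constraints need no dynamics: every value of `f` and of `g` lies in its range.
    · exact (hout.range_f k).subset ⟨State.mu (z t) k, rfl⟩
    · exact (hout.range_g i).subset ⟨State.theta (z t) i, rfl⟩
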